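/- **Setting.** Consider the plant $x(k+1)=Ax(k)+Bu(k)$, $y(k)=Cx(k)$ with $x\in\mathbb R^n$, $u\in\mathbb R^m$, $y\in\mathbb R^p$, $(A,B)$ stabilizable and $(A,C)$ observable, and weights $Q_y=Q_y^{T}\ge 0$, $R=R^{T}>0$ such that $(A,\sqrt{C^TQ_yC})$ is observable. Let $P^*$ be the unique symmetric positive semi-definite solution of $$A^TPA-P+C^TQ_yC-A^TPB(R+B^TPB)^{-1}B^TPA=0,\qquad K^*=(R+B^TP^*B)^{-1}B^TP^*A .$$ *Internal model.* Let $L\in\mathbb R^{n\times p}$, $A_L=A-LC$, $\Lambda(z)=\det(zI-A_L)=z^n+\alpha_{n-1}z^{n-1}+\dots+\alpha_0$, let $\mathcal A$ be the companion matrix of $\Lambda$ (ones on the superdiagonal, last row $-\alpha_0,\dots,-\alpha_{n-1}$), $b=(0,\dots,0,1)^T$, and let $\mathcal A_\varepsilon\in\mathbb R^{n\times n}$ have characteristic polynomial $\Lambda$. With $n_z=n(m+p+1)$, $\mathcal G_1=\mathrm{block\,diag}[\mathcal A,\dots,\mathcal A,\mathcal A_\varepsilon]$, $\mathcal G_2=\mathrm{block\,diag}[b,\dots,b,0]$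 ($m+p$ copies of $\mathcal A$ and of $b$), the internal state $\eta=\mathrm{col}(\eta_u^1,\dots,\eta_u^m,\eta_y^1,\dots,\eta_y^p,\eta_\varepsilon)\in\mathbb R^{n_z}$ obeys $\eta(k+1)=\mathcal G_1\eta(k)+\mathcal G_2\,\mathrm{col}(u(k),y(k),0)$. *Parameterization matrix.* For $X\in\mathbb R^{n\times n}$, $v\in\mathbb R^n$ let $N(X,v)\in\mathbb R^{n\times n}$ be the matrix with $\mathrm{adj}(zI-X)v=N(X,v)(1,z,\dots,z^{n-1})^T$. Put $M_u^i=N(A_L,B_i)$, $M_y^j=N(A_L,L_j)$ ($B_i$, $L_j$ the columns of $B$, $L$), $\hat x(0)=\sum_iM_u^i\eta_u^i(0)+\sum_jM_y^j\eta_y^j(0)$, $\varepsilon_x(0)=x(0)-\hat x(0)$. Assume $N(\mathcal A_\varepsilon,\eta_\varepsilon(0))$ is nonsingular and let $$M=[M_u^1,\dots,M_u^m,M_y^1,\dots,M_y^p,\;N(A_L,\varepsilon_x(0))\,N(\mathcal A_\varepsilon,\eta_\varepsilon(0))^{-1}]\in\mathbb R^{n\times n_z},\qquad \mathcal K^*=K^*M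 .$$ *Data.* Let $\mathcal K_0\in\mathbb R^{m\times n_z}$ be admissible, i.e. the closed loop of the plant and the controller $u=-\mathcal K_0\eta$, $\eta(k+1)=\mathcal G_1\eta(k)+\mathcal G_2\,\mathrm{col}(u(k),y(k),0)$, in the state $(x,\eta)$, is asymptotically stable (all eigenvalues strictly inside the unit circle). Data are collected along a trajectory of the plant and the internal model with $u(k)=-\mathcal K_0\eta(k)+\xi(k)$, where $\xi$ is an arbitrary exploration signal. For vectors $v,w$ let $\delta_v$ be the row vector with $\delta_v\,\mathrm{vech}(P)=v^TPv$ for all symmetric $P$ (entries $v_i^2$ and $2v_iv_j$, $i<j$) and $\delta_{v,w}=(w\otimes v)^T$, so that $\delta_{v,w}\mathrm{vec}(P)=v^TPw$. Let $\Pi(k_N)$ be the matrix with rows $[\delta_{\eta(k)},\,2\delta_{\eta(k),u(k)},\,\delta_{u(k)}]$, $k=0,\dots,k_N$. *Model-free policy iteration.* For $j=0,1,2,\dots$, with $\hat u_j(k)=u(k)+\mathcal K_j\eta(k)$, compute symmetric $\mathcal P_j$, a matrix $\mathcal P_{A,B}^{(j)}\in\mathbb R^{n_z\times m}$ and symmetric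 $\mathcal P_{B,B}^{(j)}$ from the equations, $k=0,\dots,k_N$, $$[-(\delta_{\eta(k+1)}-\delta_{\eta(k)}),\;2\delta_{\eta(k),\hat u_j(k)},\;\delta_{\hat u_j(k)}]\begin{bmatrix}\mathrm{vech}(\mathcal P_j)\\ \mathrm{vec}(\mathcal P_{A,B}^{(j)})\\ \mathrm{vech}(\mathcal P_{B,B}^{(j)})\end{bmatrix}=[\delta_{y(k)},\;\delta_{\eta(k)}]\begin{bmatrix}\mathrm{vech}(Q_y)\\ \mathrm{vech}(\mathcal K_j^TR\mathcal K_j)\end{bmatrix},$$ and put $\mathcal K_{j+1}=(R+\mathcal P_{B,B}^{(j)})^{-1}\big((\mathcal P_{A,B}^{(j)})^T+\mathcal P_{B,B}^{(j)}\mathcal K_j\big)$. **Theorem 5.** If $\mathrm{rank}\,\Pi(k_N)=\frac{(n_z+m)(n_z+m+1)}2$ for some $k_N$ and $\mathrm{rank}(M)=n$, then for every admissible initial gain $\mathcal K_0$ the matrix $P^*$ exists and is unique, the model-free policy iteration run with the data of the instants $0,\dots,k_N$ (and $\eta(k_N+1)$) can be carried out for all $j$, and every sequence of gains $\mathcal K_j$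 that it generates satisfies $\lim_{j\to\infty}\mathcal K_j=\mathcal K^*$. -/

import Mathlib

open Filter Topology Polynomial

/-! ### Half-vectorization and data regressors -/

/-- `vech C`: the entries `c_{ij}` of a symmetric matrix, one for each unordered pair `{i, j}`.
(Averaging the two mirror entries makes the definition total; for symmetric `C` the entry at
`s(i, j)` is `C i j`.) -/
noncomputable def vech {ι : Type*} (C : Matrix ι ι ℝ) : Sym2 ι → ℝ :=
  Sym2.lift ⟨fun i j => (C i j + C j i) / 2, fun _ _ => congrArg (· / 2) (add_comm _ _)⟩

/-- `δ_v = vech (2 v vᵀ - dia(v)²)`, so that `δ_v · vech P = vᵀ P v` for symmetric `P`. -/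
noncomputable def deltaSym {ι : Type*} [Fintype ι] [DecidableEq ι] (v : ι → ℝ) : Sym2 ι → ℝ :=
  vech ((2 : ℝ) • Matrix.vecMulVec v v - Matrix.diagonal v ^ 2)

/-- `δ_{v,w} = w ⊗ v`, so that `δ_{v,w} · vec P = vᵀ P w`. -/
def deltaPair {ι κ : Type*} (v : ι → ℝ) (w : κ → ℝ) : κ × ι → ℝ :=
  fun q => w q.1 * v q.2

/-! ### Linear systems -/

/-- All (complex) eigenvalues lie strictly inside the unit circle. -/
def IsSchur {ι : Type*} [Fintype ι] [DecidableEq ι] (X : Matrix ι ι ℝ) : Prop :=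
  ∀ μ ∈ spectrum ℂ (X.map (fun r : ℝ => (r : ℂ))), ‖μ‖ < 1

/-- The pair `(A, B)` is stabilizable. -/
def IsStabilizable {n m : ℕ} (A : Matrix (Fin n) (Fin n) ℝ) (B : Matrix (Fin n) (Fin m) ℝ) :
    Prop :=
  ∃ K : Matrix (Fin m) (Fin n) ℝ, IsSchur (A - B * K)

/-- The pair `(A, C)` is observable: the unobservable subspace is trivial. -/
def IsObservable {n p : ℕ} (A : Matrix (Fin n) (Fin n) ℝ) (C : Matrix (Fin p) (Fin n) ℝ) :
    Prop :=
  ∀ v : Fin n → ℝ, (∀ k : ℕ, Matrix.mulVec (C * A ^ k) v = 0) → v = 0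

/-- `P` is a (symmetric) positive semi-definite solution of the discrete algebraic Riccati
equation `Aᵀ P A - P + Cᵀ Q C - Aᵀ P B (R + Bᵀ P B)⁻¹ Bᵀ P A = 0`. -/
def IsRiccatiSolution {n m p : ℕ} (A : Matrix (Fin n) (Fin n) ℝ) (B : Matrix (Fin n) (Fin m) ℝ)
    (C : Matrix (Fin p) (Fin n) ℝ) (Q : Matrix (Fin p) (Fin p) ℝ) (R : Matrix (Fin m) (Fin m) ℝ)
    (P : Matrix (Fin n) (Fin n) ℝ) : Prop :=
  P.PosSemidef ∧
    A.transpose * P * A - P + C.transpose * Q * C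
      - A.transpose * P * B * (R + B.transpose * P * B)⁻¹ * B.transpose * P * A = 0

/-- The state feedback gain `(R + Bᵀ P B)⁻¹ Bᵀ P A`. -/
noncomputable def lqrGain {n m : ℕ} (A : Matrix (Fin n) (Fin n) ℝ) (B : Matrix (Fin n) (Fin m) ℝ)
    (R : Matrix (Fin m) (Fin m) ℝ) (P : Matrix (Fin n) (Fin n) ℝ) : Matrix (Fin m) (Fin n) ℝ :=
  (R + B.transpose * P * B)⁻¹ * B.transpose * P * A

/-! ### The internal model -/

/-- The blocks of the internal model: one per input, one per output, and the error block. -/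
abbrev Chan (m p : ℕ) : Type := Fin m ⊕ Fin p ⊕ Unit

/-- Index set of the internal state `η`; it has `n (m + p + 1)` elements. -/
abbrev EtaIdx (n m p : ℕ) : Type := Fin n × Chan m p

/-- Companion matrix (coefficients in the last row) of the monic polynomial
`zⁿ + α_{n-1} zⁿ⁻¹ + ⋯ + α₀`, where `α_k` is the coefficient of `z^k` in `q`. -/
noncomputable def companionMat (n : ℕ) (q : ℝ[X]) : Matrix (Fin n) (Fin n) ℝ :=
  Matrix.of fun i j =>
    if (i : ℕ) + 1 = n then -q.coeff (j : ℕ)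
    else if (j : ℕ) = (i : ℕ) + 1 then 1 else 0

/-- The vector `b = (0, …, 0, 1)`. -/
def lastVec (n : ℕ) : Fin n → ℝ := fun i => if (i : ℕ) + 1 = n then 1 else 0

/-- `𝒢₁ = block diag [𝒜, …, 𝒜, 𝒜_ε]`, with `𝒜` the companion matrix of `det (z I - A_L)`. -/
noncomputable def internalG1 {n : ℕ} (m p : ℕ) (AL Aeps : Matrix (Fin n) (Fin n) ℝ) :
    Matrix (EtaIdx n m p) (EtaIdx n m p) ℝ :=
  Matrix.blockDiagonal fun c : Chan m p =>
    match c with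
    | Sum.inl _ => companionMat n AL.charpoly
    | Sum.inr (Sum.inl _) => companionMat n AL.charpoly
    | Sum.inr (Sum.inr _) => Aeps

/-- `𝒢₂ = block diag [b, …, b, 0]`. -/
def internalG2 (n m p : ℕ) : Matrix (EtaIdx n m p) (Chan m p) ℝ :=
  Matrix.of fun q d =>
    if q.2 = d then
      match d with
      | Sum.inl _ => lastVec n q.1
      | Sum.inr (Sum.inl _) => lastVec n q.1
      | Sum.inr (Sum.inr _) => 0
    else 0

/-- `ζ = col (u, y, 0)`. -/
def zetaVec {m p : ℕ} (u : Fin m → ℝ) (y : Fin p → ℝ) : Chan m p → ℝ :=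
  Sum.elim u (Sum.elim y fun _ => 0)

/-- The matrix whose column `k` is the coefficient of `z^k` in `adj (z I - X) v`, i.e.
`(z I - X)⁻¹ v = (coeffMat X v) (1, z, …, zⁿ⁻¹)ᵀ / det (z I - X)`. -/
noncomputable def coeffMat {n : ℕ} (X : Matrix (Fin n) (Fin n) ℝ) (v : Fin n → ℝ) :
    Matrix (Fin n) (Fin n) ℝ :=
  Matrix.of fun i k =>
    (Matrix.mulVec (Matrix.adjugate (Matrix.charmatrix X)) (fun j => Polynomial.C (v j)) i).coeff
      (k : ℕ)

/-- The observer state `x̂ = ∑ᵢ M_uⁱ η_uⁱ + ∑ⱼ M_yʲ η_yʲ` encoded in `η`. -/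
noncomputable def observerState {n m p : ℕ} (A : Matrix (Fin n) (Fin n) ℝ)
    (B : Matrix (Fin n) (Fin m) ℝ) (C : Matrix (Fin p) (Fin n) ℝ) (L : Matrix (Fin n) (Fin p) ℝ)
    (η : EtaIdx n m p → ℝ) : Fin n → ℝ :=
  (∑ a : Fin m, Matrix.mulVec (coeffMat (A - L * C) fun i => B i a) fun i => η (i, Sum.inl a))
  + ∑ b : Fin p, Matrix.mulVec (coeffMat (A - L * C) fun i => L i b)
      fun i => η (i, Sum.inr (Sum.inl b))

/-- The error block `η_ε` of `η`. -/
def errorBlock {n m p : ℕ} (η : EtaIdx n m p → ℝ) : Fin n → ℝ :=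
  fun i => η (i, Sum.inr (Sum.inr ()))

/-- The parameterization matrix `M = [M_u¹, …, M_uᵐ, M_y¹, …, M_yᵖ, M_ε M_η⁻¹]`, where
`M_ε` is built from the initial observer error `ε₀` and `M_η` from `𝒜_ε` and `η_ε(0)`. -/
noncomputable def paramMatrix {n m p : ℕ} (A : Matrix (Fin n) (Fin n) ℝ)
    (B : Matrix (Fin n) (Fin m) ℝ) (C : Matrix (Fin p) (Fin n) ℝ) (L : Matrix (Fin n) (Fin p) ℝ)
    (Aeps : Matrix (Fin n) (Fin n) ℝ) (x0 : Fin n → ℝ) (η0 : EtaIdx n m p → ℝ) :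
    Matrix (Fin n) (EtaIdx n m p) ℝ :=
  Matrix.of fun i q =>
    match q.2 with
    | Sum.inl a => coeffMat (A - L * C) (fun r => B r a) i q.1
    | Sum.inr (Sum.inl b) => coeffMat (A - L * C) (fun r => L r b) i q.1
    | Sum.inr (Sum.inr _) =>
        (coeffMat (A - L * C) (x0 - observerState A B C L η0)
          * (coeffMat Aeps (errorBlock η0))⁻¹) i q.1

/-- System matrix, in the state `(x, η)`, of the closed loop of the plant
`x⁺ = A x + B u`, `y = C x` with the controller `u = -𝒦 η`, `η⁺ = 𝒢₁ η + 𝒢₂ col (u, y, 0)`. -/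
noncomputable def closedLoop {n m p : ℕ} (A : Matrix (Fin n) (Fin n) ℝ)
    (B : Matrix (Fin n) (Fin m) ℝ) (C : Matrix (Fin p) (Fin n) ℝ) (L : Matrix (Fin n) (Fin p) ℝ)
    (Aeps : Matrix (Fin n) (Fin n) ℝ) (K : Matrix (Fin m) (EtaIdx n m p) ℝ) :
    Matrix (Fin n ⊕ EtaIdx n m p) (Fin n ⊕ EtaIdx n m p) ℝ :=
  Matrix.fromBlocks
    A (-(B * K))
    ((internalG2 n m p).submatrix id (fun b : Fin p => Sum.inr (Sum.inl b)) * C)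
    (internalG1 m p (A - L * C) Aeps
      - (internalG2 n m p).submatrix id (fun a : Fin m => Sum.inl a) * K)

/-- The gain `𝒦` is admissible: the dynamic output feedback controller with gain `𝒦` makes the
closed loop asymptotically stable. -/
def IsAdmissible {n m p : ℕ} (A : Matrix (Fin n) (Fin n) ℝ)
    (B : Matrix (Fin n) (Fin m) ℝ) (C : Matrix (Fin p) (Fin n) ℝ) (L : Matrix (Fin n) (Fin p) ℝ)
    (Aeps : Matrix (Fin n) (Fin n) ℝ) (K : Matrix (Fin m) (EtaIdx n m p) ℝ) : Prop :=
  IsSchur (closedLoop A B C L Aeps K)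

/-! ### The data matrices and the model-free policy iteration -/

/-- `Π(N) = col (φ(0), …, φ(N))` with `φ(k) = [δ_η(k), 2 δ_{η,u}(k), δ_u(k)]`. -/
noncomputable def dataPi {ι : Type*} [Fintype ι] [DecidableEq ι] {m : ℕ} (N : ℕ)
    (η : ℕ → ι → ℝ) (u : ℕ → Fin m → ℝ) :
    Matrix (Fin (N + 1)) (Sym2 ι ⊕ (Fin m × ι) ⊕ Sym2 (Fin m)) ℝ :=
  Matrix.of fun k =>
    Sum.elim (deltaSym (η k))
      (Sum.elim ((2 : ℝ) • deltaPair (η k) (u k)) (deltaSym (u k)))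

/-- `Π̂(N)` for the gain `𝒦`: row `k` is `[-(δ_η(k+1) - δ_η(k)), 2 δ_{η,û}(k), δ_û(k)]`
with `û(k) = u(k) + 𝒦 η(k)`. -/
noncomputable def dataPiHat {ι : Type*} [Fintype ι] [DecidableEq ι] {m : ℕ} (N : ℕ)
    (η : ℕ → ι → ℝ) (u : ℕ → Fin m → ℝ) (K : Matrix (Fin m) ι ℝ) :
    Matrix (Fin (N + 1)) (Sym2 ι ⊕ (Fin m × ι) ⊕ Sym2 (Fin m)) ℝ :=
  Matrix.of fun k =>
    Sum.elim (-(deltaSym (η (k + 1)) - deltaSym (η k)))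
      (Sum.elim ((2 : ℝ) • deltaPair (η k) (u k + Matrix.mulVec K (η k)))
        (deltaSym (u k + Matrix.mulVec K (η k))))

/-- `Φ(N)`: row `k` is `[δ_y(k), δ_η(k)]`. -/
noncomputable def dataPhi {ι : Type*} [Fintype ι] [DecidableEq ι] {p : ℕ} (N : ℕ)
    (η : ℕ → ι → ℝ) (y : ℕ → Fin p → ℝ) :
    Matrix (Fin (N + 1)) (Sym2 (Fin p) ⊕ Sym2 ι) ℝ :=
  Matrix.of fun k => Sum.elim (deltaSym (y k)) (deltaSym (η k))

/-- The symmetric matrix `P`, the matrix `PAB` and the symmetric matrix `PBB` solve the learning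
equation of the model-free policy iteration for the gain `𝒦`, with the data of the
instants `0, …, N` (and `η(N+1)`). -/
def SolvesLearningEq {ι : Type*} [Fintype ι] [DecidableEq ι] {m p : ℕ} (N : ℕ)
    (η : ℕ → ι → ℝ) (u : ℕ → Fin m → ℝ) (y : ℕ → Fin p → ℝ)
    (Q : Matrix (Fin p) (Fin p) ℝ) (R : Matrix (Fin m) (Fin m) ℝ) (K : Matrix (Fin m) ι ℝ)
    (P : Matrix ι ι ℝ) (PAB : Matrix ι (Fin m) ℝ) (PBB : Matrix (Fin m) (Fin m) ℝ) : Prop :=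
  P.IsSymm ∧ PBB.IsSymm ∧
    Matrix.mulVec (dataPiHat N η u K) (Sum.elim (vech P) (Sum.elim PAB.vec (vech PBB)))
      = Matrix.mulVec (dataPhi N η y) (Sum.elim (vech Q) (vech (K.transpose * R * K)))

/-- `(P_j, PAB_j, PBB_j, 𝒦_j)_{j ≥ 0}` is generated by the model-free policy iteration from the
initial gain `𝒦₀`: for every `j`, the triple is computed from the learning equation for `𝒦_j`, and
`𝒦_{j+1} = (R + PBB_j)⁻¹ (PAB_jᵀ + PBB_j 𝒦_j)`. -/
structure IsPIRun {ι : Type*} [Fintype ι] [DecidableEq ι] {m p : ℕ} (N : ℕ)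
    (η : ℕ → ι → ℝ) (u : ℕ → Fin m → ℝ) (y : ℕ → Fin p → ℝ)
    (Q : Matrix (Fin p) (Fin p) ℝ) (R : Matrix (Fin m) (Fin m) ℝ) (K₀ : Matrix (Fin m) ι ℝ)
    (P : ℕ → Matrix ι ι ℝ) (PAB : ℕ → Matrix ι (Fin m) ℝ) (PBB : ℕ → Matrix (Fin m) (Fin m) ℝ)
    (K : ℕ → Matrix (Fin m) ι ℝ) : Prop where
  init : K 0 = K₀
  learning : ∀ j, SolvesLearningEq N η u y Q R (K j) (P j) (PAB j) (PBB j)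
  update : ∀ j, K (j + 1) = (R + PBB j)⁻¹ * ((PAB j).transpose + PBB j * K j)

/-! ### Stability of matrices -/

section Stability
open Matrix

/-! The data are full-state data of a larger linear system, and the algorithm is policy iteration
for that system. The columns of `M` are coefficients of `adj (z I - A_L) v`, so `M` intertwines `𝒢₁`
with `A_L` and maps the input and output columns of `𝒢₂` to `B` and `L`. Since also `M η(0) = x(0)`,
the trajectory satisfies `x = M η`, whence `η⁺ = 𝔸 η + 𝔹 u` and `y = C M η` with `𝔸 = 𝒢₁ + 𝒢₂ʸ C M`,
`𝔹 = 𝒢₂ᵘ`, and the plant is a quotient of this lift: `M 𝔸 = A M`, `M 𝔹 = B` (`mul_liftedA`).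

Full column rank of `Π` makes the learning equation equivalent to the Lyapunov equation for the cost
of `𝒦_j` in the lift (`solvesLearningEq_iff`), and the update is then the greedy gain. The closed
loop restricted to `x = M η` is `𝔸 - 𝔹 𝒦₀`, so the iteration starts from a stabilizing gain.
Completion of squares preserves stability and makes the costs decrease, so they converge to a
Riccati solution of the lift (`policyIteration_tendsto`).

The weight of the lift vanishes on `ker M`, so uniqueness is not sought there. Instead, on `ker M`
the free motion is that of `𝒢₁`: it has zero output and decays, because `A_L` is a quotient of the
admissible closed loop. Hence the limit cost vanishes on `ker M` and equals `Mᵀ X M` with `X` a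
Riccati solution of the plant (`exists_isRiccatiSolution_of_lift`). Observability of `(A, S)` makes
`X` unique, and the limit gain is the optimal gain of `X` times `M`. -/

theorem map_ofReal_mulVec_re {ι κ : Type*} [Fintype ι] (X : Matrix κ ι ℝ) (v : ι → ℂ) (i : κ) :
    ((X.map (fun r : ℝ => (r : ℂ)) *ᵥ v) i).re = (X *ᵥ fun j => (v j).re) i := by
  simp [Matrix.mulVec, dotProduct]

theorem map_ofReal_mulVec_im {ι κ : Type*} [Fintype ι] (X : Matrix κ ι ℝ) (v : ι → ℂ) (i : κ) :
    ((X.map (fun r : ℝ => (r : ℂ)) *ᵥ v) i).im = (X *ᵥ fun j => (v j).im) i := by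
  simp [Matrix.mulVec, dotProduct]

variable {ι κ : Type*} [Fintype ι] [DecidableEq ι] [Fintype κ] [DecidableEq κ]

theorem mem_spectrum_iff_exists_mulVec (Y : Matrix ι ι ℂ) (μ : ℂ) :
    μ ∈ spectrum ℂ Y ↔ ∃ v, v ≠ 0 ∧ Y *ᵥ v = μ • v := by
  rw [spectrum.mem_iff, Matrix.isUnit_iff_isUnit_det, isUnit_iff_ne_zero, not_not,
    ← Matrix.exists_mulVec_eq_zero_iff]
  refine exists_congr fun v => and_congr_right fun _ => ?_
  rw [Matrix.sub_mulVec, sub_eq_zero, Algebra.algebraMap_eq_smul_one, Matrix.smul_mulVec,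
    Matrix.one_mulVec, eq_comm]

/-- `IsSchur` in terms of the real and imaginary parts of eigenvectors. -/
theorem isSchur_iff_real (X : Matrix ι ι ℝ) :
    IsSchur X ↔ ∀ (α β : ℝ) (a b : ι → ℝ), X *ᵥ a = α • a - β • b → X *ᵥ b = β • a + α • b →
      1 ≤ α ^ 2 + β ^ 2 → a = 0 ∧ b = 0 := by
  constructor
  · intro h α β a b ha hb hab
    by_contra hne
    have hv : (fun i => (⟨a i, b i⟩ : ℂ)) ≠ 0 := by
      intro h0
      refine hne ⟨funext fun i => ?_, funext fun i => ?_⟩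
      · simpa using congrArg Complex.re (congrFun h0 i)
      · simpa using congrArg Complex.im (congrFun h0 i)
    have hlt := h ⟨α, β⟩ ((mem_spectrum_iff_exists_mulVec _ _).2 ⟨_, hv, by
      funext i
      apply Complex.ext
      · rw [map_ofReal_mulVec_re]
        simpa using congrFun ha i
      · rw [map_ofReal_mulVec_im]
        simpa [add_comm] using congrFun hb i⟩)
    have hsq : ‖(⟨α, β⟩ : ℂ)‖ ^ 2 = α ^ 2 + β ^ 2 := by
      rw [Complex.sq_norm, Complex.normSq_mk]; ring
    have := norm_nonneg (⟨α, β⟩ : ℂ)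
    nlinarith
  · intro h μ hμ
    obtain ⟨v, hv, hYv⟩ := (mem_spectrum_iff_exists_mulVec _ _).1 hμ
    by_contra hlt
    have hsq : ‖μ‖ ^ 2 = μ.re ^ 2 + μ.im ^ 2 := by
      rw [Complex.sq_norm, Complex.normSq_apply]; ring
    obtain ⟨ha, hb⟩ := h μ.re μ.im (fun i => (v i).re) (fun i => (v i).im)
      (by
        funext i
        rw [← map_ofReal_mulVec_re, hYv]
        simp)
      (by
        funext i
        rw [← map_ofReal_mulVec_im, hYv]
        simp [add_comm])
      (by nlinarith [not_lt.1 hlt])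
    exact hv (funext fun i => Complex.ext (congrFun ha i) (congrFun hb i))

theorem tendsto_zero_of_map_ofReal {ι : Type*} {X : ℕ → Matrix ι ι ℝ}
    (h : Tendsto (fun k => (X k).map (fun r : ℝ => (r : ℂ))) atTop (𝓝 0)) :
    Tendsto X atTop (𝓝 0) := by
  refine tendsto_pi_nhds.2 fun i => tendsto_pi_nhds.2 fun j => ?_
  have := (Complex.continuous_re.tendsto _).comp (tendsto_pi_nhds.1 (tendsto_pi_nhds.1 h i) j)
  simpa [Function.comp_def] using this

theorem map_ofReal_pow (X : Matrix ι ι ℝ) (k : ℕ) :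
    (X ^ k).map (fun r : ℝ => (r : ℂ)) = X.map (fun r : ℝ => (r : ℂ)) ^ k :=
  map_pow (Complex.ofRealHom.mapMatrix) X k

attribute [local instance] Matrix.linftyOpNormedRing Matrix.linftyOpNormedAlgebra in
/-- The powers of a Schur matrix tend to zero. -/
theorem IsSchur.tendsto_pow {X : Matrix ι ι ℝ} (h : IsSchur X) :
    Tendsto (fun k => X ^ k) atTop (𝓝 0) := by
  rcases isEmpty_or_nonempty ι with hι | hι
  · exact tendsto_const_nhds.congr fun k => Subsingleton.elim _ _
  apply tendsto_zero_of_map_ofReal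
  simp only [map_ofReal_pow]
  set Y : Matrix ι ι ℂ := X.map (fun r : ℝ => (r : ℂ)) with hY
  have hr : spectralRadius ℂ Y < ((1 : NNReal) : ENNReal) :=
    spectrum.spectralRadius_lt_of_forall_lt Y fun z hz => by
      have := h z hz
      exact_mod_cast this
  -- Gelfand's formula: for `r` strictly between the spectral radius and `1`, eventually `‖Y ^ k‖ <
  -- r ^ k`.
  obtain ⟨r, hr1, hr2⟩ := ENNReal.lt_iff_exists_nnreal_btwn.1 hr
  have hev := (spectrum.pow_nnnorm_pow_one_div_tendsto_nhds_spectralRadius Y).eventually_lt_const hr1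
  have hr2' : r < 1 := by exact_mod_cast hr2
  refine squeeze_zero_norm' (a := fun k : ℕ => (r : ℝ) ^ k) ?_
    (tendsto_pow_atTop_nhds_zero_of_lt_one r.2 (by exact_mod_cast hr2'))
  filter_upwards [hev, eventually_gt_atTop 0] with k hk hk0
  have hk' : (k : ℝ) ≠ 0 := by positivity
  have h1 := ENNReal.rpow_lt_rpow hk (show (0 : ℝ) < k by positivity)
  rw [← ENNReal.rpow_mul, one_div, inv_mul_cancel₀ hk', ENNReal.rpow_one,
    ENNReal.rpow_natCast] at h1
  have h2 : ‖Y ^ k‖₊ < r ^ k := by exact_mod_cast h1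
  exact_mod_cast h2.le

/-- On the real plane of an eigenvector with `|μ| ≥ 1`, powers of `X` act as multiplication by `μ ^
k`, so `|a|² + |b|²` cannot decay unless it is zero. -/
theorem isSchur_of_tendsto_pow {X : Matrix ι ι ℝ} (h : Tendsto (fun k => X ^ k) atTop (𝓝 0)) :
    IsSchur X := by
  rw [isSchur_iff_real]
  intro α β a b ha hb hab
  have ht : ∀ w : ι → ℝ, Tendsto (fun k => (X ^ k *ᵥ w)) atTop (𝓝 0) := fun w => by
    have hc : Continuous fun Z : Matrix ι ι ℝ => Z *ᵥ w := by fun_prop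
    simpa [Function.comp_def] using (hc.tendsto 0).comp h
  have hexp : ∀ k, a ⬝ᵥ a + b ⬝ᵥ b ≤
      (X ^ k *ᵥ a) ⬝ᵥ (X ^ k *ᵥ a) + (X ^ k *ᵥ b) ⬝ᵥ (X ^ k *ᵥ b) := by
    -- Here `α'` and `β'` are the real and imaginary parts of `μ ^ k`, where `μ = α + iβ`.
    suffices hk : ∀ k, ∃ α' β' : ℝ, X ^ k *ᵥ a = α' • a - β' • b ∧ X ^ k *ᵥ b = β' • a + α' • b ∧
        1 ≤ α' ^ 2 + β' ^ 2 by
      intro k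
      obtain ⟨α', β', h1, h2, h3⟩ := hk k
      have hsum : (X ^ k *ᵥ a) ⬝ᵥ (X ^ k *ᵥ a) + (X ^ k *ᵥ b) ⬝ᵥ (X ^ k *ᵥ b)
          = (α' ^ 2 + β' ^ 2) * (a ⬝ᵥ a + b ⬝ᵥ b) := by
        rw [h1, h2]
        simp only [sub_dotProduct, dotProduct_sub, add_dotProduct, dotProduct_add,
          smul_dotProduct, dotProduct_smul, smul_eq_mul, dotProduct_comm b a]
        ring
      rw [hsum]
      have h4 : 0 ≤ a ⬝ᵥ a + b ⬝ᵥ b := by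
        have := dotProduct_star_self_nonneg a
        have := dotProduct_star_self_nonneg b
        simp only [star_trivial] at *
        linarith
      nlinarith
    intro k
    induction k with
    | zero => exact ⟨1, 0, by simp, by simp, by norm_num⟩
    | succ k ih =>
      obtain ⟨α', β', h1, h2, h3⟩ := ih
      refine ⟨α * α' - β * β', α * β' + β * α', ?_, ?_, ?_⟩
      · rw [pow_succ', ← Matrix.mulVec_mulVec, h1, Matrix.mulVec_sub, Matrix.mulVec_smul,
          Matrix.mulVec_smul, ha, hb]
        module
      · rw [pow_succ', ← Matrix.mulVec_mulVec, h2, Matrix.mulVec_add, Matrix.mulVec_smul,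
          Matrix.mulVec_smul, ha, hb]
        module
      · nlinarith [sq_nonneg (α * α' - β * β')]
  have hlim : Tendsto (fun k => (X ^ k *ᵥ a) ⬝ᵥ (X ^ k *ᵥ a) + (X ^ k *ᵥ b) ⬝ᵥ (X ^ k *ᵥ b))
      atTop (𝓝 0) := by
    have hc : Continuous fun p : (ι → ℝ) × (ι → ℝ) => p.1 ⬝ᵥ p.1 + p.2 ⬝ᵥ p.2 := by fun_prop
    simpa [Function.comp_def] using
      (hc.tendsto (0, 0)).comp ((ht a).prodMk_nhds (ht b))
  have hle := ge_of_tendsto' hlim hexp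
  have ha0 := dotProduct_star_self_nonneg a
  have hb0 := dotProduct_star_self_nonneg b
  simp only [star_trivial] at ha0 hb0
  exact ⟨dotProduct_self_eq_zero.1 (by linarith), dotProduct_self_eq_zero.1 (by linarith)⟩

theorem isSchur_of_charpoly_eq {X : Matrix ι ι ℝ} {Y : Matrix κ κ ℝ} (hX : IsSchur X)
    (h : Y.charpoly = X.charpoly) : IsSchur Y := by
  intro μ hμ
  apply hX μ
  rw [Matrix.mem_spectrum_iff_isRoot_charpoly] at hμ ⊢
  have hX' : (X.map (fun r : ℝ => (r : ℂ))).charpoly = X.charpoly.map Complex.ofRealHom :=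
    Matrix.charpoly_map X Complex.ofRealHom
  have hY' : (Y.map (fun r : ℝ => (r : ℂ))).charpoly = Y.charpoly.map Complex.ofRealHom :=
    Matrix.charpoly_map Y Complex.ofRealHom
  rwa [hX', ← h, ← hY']

theorem intertwine_pow {α : Type*} [Semiring α] {T : Matrix κ ι α} {X : Matrix ι ι α}
    {Y : Matrix κ κ α} (h : T * X = Y * T) (k : ℕ) : T * X ^ k = Y ^ k * T := by
  induction k with
  | zero => simp
  | succ k ih => rw [pow_succ, ← Matrix.mul_assoc, ih, Matrix.mul_assoc, h, ← Matrix.mul_assoc,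
      ← pow_succ]

/-- A quotient of a Schur matrix is Schur. -/
theorem IsSchur.of_quotient {X : Matrix ι ι ℝ} {Y : Matrix κ κ ℝ} (hX : IsSchur X)
    {T : Matrix κ ι ℝ} {T' : Matrix ι κ ℝ} (hT : T * T' = 1) (h : T * X = Y * T) : IsSchur Y := by
  apply isSchur_of_tendsto_pow
  have hc : Continuous fun Z : Matrix ι ι ℝ => T * Z * T' := by fun_prop
  have h1 := (hc.tendsto 0).comp hX.tendsto_pow
  simp only [Matrix.mul_zero, Matrix.zero_mul] at h1
  refine h1.congr fun k => ?_
  rw [Function.comp_apply, intertwine_pow h, Matrix.mul_assoc, hT, Matrix.mul_one]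

/-- The restriction of a Schur matrix to an invariant subspace is Schur. -/
theorem IsSchur.of_restrict {X : Matrix ι ι ℝ} {Y : Matrix κ κ ℝ} (hX : IsSchur X)
    {J : Matrix ι κ ℝ} {J' : Matrix κ ι ℝ} (hJ : J' * J = 1) (h : X * J = J * Y) : IsSchur Y := by
  apply isSchur_of_tendsto_pow
  have hc : Continuous fun Z : Matrix ι ι ℝ => J' * Z * J := by fun_prop
  have h1 := (hc.tendsto 0).comp hX.tendsto_pow
  simp only [Matrix.mul_zero, Matrix.zero_mul] at h1
  refine h1.congr fun k => ?_
  rw [Function.comp_apply, Matrix.mul_assoc, ← intertwine_pow h.symm, ← Matrix.mul_assoc, hJ,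
    Matrix.one_mul]

end Stability

/-! ### Coefficients of `adj (z I - X) v` -/

section CoeffMat
open Matrix

variable {n : ℕ}

/-- The coefficient of `z ^ k` in `adj (z I - X) v`. -/
noncomputable def adjCoeff (X : Matrix (Fin n) (Fin n) ℝ) (v : Fin n → ℝ) (k : ℕ) : Fin n → ℝ :=
  fun i => ((X.charmatrix.adjugate *ᵥ fun j => Polynomial.C (v j)) i).coeff k

theorem charmatrix_mulVec_coeff (X : Matrix (Fin n) (Fin n) ℝ) (w : Fin n → ℝ[X]) (i : Fin n)
    (k : ℕ) : ((X.charmatrix *ᵥ w) i).coeff k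
      = (Polynomial.X * w i).coeff k - (X *ᵥ fun j => (w j).coeff k) i := by
  have h : X.charmatrix *ᵥ w = fun i => Polynomial.X * w i - ∑ j, Polynomial.C (X i j) * w j := by
    funext i
    rw [Matrix.charmatrix, Matrix.sub_mulVec]
    simp [Matrix.mulVec, dotProduct]
  rw [h]
  simp [Matrix.mulVec, dotProduct]

theorem charmatrix_mulVec_adjugate (X : Matrix (Fin n) (Fin n) ℝ) (v : Fin n → ℝ) :
    X.charmatrix *ᵥ (X.charmatrix.adjugate *ᵥ fun j => Polynomial.C (v j))
      = fun i => X.charpoly * Polynomial.C (v i) := by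
  rw [Matrix.mulVec_mulVec, Matrix.mul_adjugate, Matrix.smul_mulVec, Matrix.one_mulVec]
  rfl

/-- Compare coefficients of `z ^ (k + 1)` in `(z I - X) adj (z I - X) v = χ(z) v`. -/
theorem mulVec_adjCoeff_succ (X : Matrix (Fin n) (Fin n) ℝ) (v : Fin n → ℝ) (k : ℕ) :
    X *ᵥ adjCoeff X v (k + 1) = adjCoeff X v k - X.charpoly.coeff (k + 1) • v := by
  funext i
  have h := congrArg (fun q => q.coeff (k + 1)) (congrFun (charmatrix_mulVec_adjugate X v) i)
  simp only [charmatrix_mulVec_coeff, Polynomial.coeff_X_mul, Polynomial.coeff_mul_C] at h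
  simp only [Pi.sub_apply, Pi.smul_apply, smul_eq_mul]
  rw [← h]
  simp only [adjCoeff]
  ring!

theorem mulVec_adjCoeff_zero (X : Matrix (Fin n) (Fin n) ℝ) (v : Fin n → ℝ) :
    X *ᵥ adjCoeff X v 0 = - X.charpoly.coeff 0 • v := by
  funext i
  have h := congrArg (fun q => q.coeff 0) (congrFun (charmatrix_mulVec_adjugate X v) i)
  simp only [charmatrix_mulVec_coeff, Polynomial.mul_coeff_zero, Polynomial.coeff_X_zero,
    zero_mul, zero_sub, Polynomial.coeff_C_zero] at h
  simp only [Pi.smul_apply, smul_eq_mul, neg_mul, ← h, neg_neg]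
  rfl

/-- Past the degree of `χ` the recurrence reads `w_k = X w_{k+1}`. Iterating reaches indices beyond
the degree of every entry, so no degree bound on the adjugate is needed. -/
theorem adjCoeff_of_le (X : Matrix (Fin n) (Fin n) ℝ) (v : Fin n → ℝ) {k : ℕ} (hk : n ≤ k) :
    adjCoeff X v k = 0 := by
  have hstep : ∀ j, adjCoeff X v k = X ^ j *ᵥ adjCoeff X v (k + j) := by
    intro j
    induction j with
    | zero => simp
    | succ j ih =>
      have h0 : X.charpoly.coeff (k + j + 1) = 0 :=
        Polynomial.coeff_eq_zero_of_natDegree_lt (by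
          rw [Matrix.charpoly_natDegree_eq_dim, Fintype.card_fin]; omega)
      rw [ih, pow_succ, ← Matrix.mulVec_mulVec, ← add_assoc, mulVec_adjCoeff_succ, h0, zero_smul,
        sub_zero]
  let w := X.charmatrix.adjugate *ᵥ fun j => Polynomial.C (v j)
  have hbig : adjCoeff X v (k + (∑ i, (w i).natDegree + 1)) = 0 := by
    funext i
    refine Polynomial.coeff_eq_zero_of_natDegree_lt ?_
    have := Finset.single_le_sum (f := fun i => (w i).natDegree) (fun _ _ => Nat.zero_le _)
      (Finset.mem_univ i)
    change (w i).natDegree < _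
    omega
  rw [hstep, hbig, Matrix.mulVec_zero]

theorem adjCoeff_pred (X : Matrix (Fin n) (Fin n) ℝ) (v : Fin n → ℝ) {k : ℕ} (hk : k + 1 = n) :
    adjCoeff X v k = v := by
  have h := mulVec_adjCoeff_succ X v k
  have h1 : X.charpoly.coeff (k + 1) = 1 := by
    rw [hk]
    have := X.charpoly_monic.coeff_natDegree
    rwa [Matrix.charpoly_natDegree_eq_dim, Fintype.card_fin] at this
  rw [adjCoeff_of_le X v hk.ge, Matrix.mulVec_zero, h1, one_smul] at h
  exact sub_eq_zero.1 h.symm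

theorem coeffMat_apply (X : Matrix (Fin n) (Fin n) ℝ) (v : Fin n → ℝ) (i k : Fin n) :
    coeffMat X v i k = adjCoeff X v k i := rfl

theorem coeffMat_mulVec_lastVec (X : Matrix (Fin n) (Fin n) ℝ) (v : Fin n → ℝ) :
    coeffMat X v *ᵥ lastVec n = v := by
  funext i
  have hn := i.isLt
  obtain ⟨m, rfl⟩ : ∃ m, n = m + 1 := ⟨n - 1, by omega⟩
  have : ∀ j : Fin (m + 1), lastVec (m + 1) j = if j = Fin.last m then 1 else 0 := fun j => by
    simp [lastVec, Fin.ext_iff]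
  simp only [Matrix.mulVec, dotProduct, this, mul_ite, mul_one, mul_zero, Finset.sum_ite_eq',
    Finset.mem_univ, if_true, coeffMat_apply]
  rw [adjCoeff_pred X v (by simp)]

/-- The recurrence `X w_k = w_{k-1} - α_k v`, read column by column: the superdiagonal shifts
columns, and the last row contributes `-α_k` times the last column, which is `v`. -/
theorem coeffMat_mul_companionMat (X : Matrix (Fin n) (Fin n) ℝ) (v : Fin n → ℝ) :
    coeffMat X v * companionMat n X.charpoly = X * coeffMat X v := by
  ext i k
  have hR : (X * coeffMat X v) i k = (X *ᵥ adjCoeff X v k) i := rfl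
  obtain ⟨m, rfl⟩ : ∃ m, n = m + 1 := ⟨n - 1, by have := i.isLt; omega⟩
  rw [hR, Matrix.mul_apply, Fin.sum_univ_castSucc]
  have hlast : coeffMat X v i (Fin.last m) * companionMat (m + 1) X.charpoly (Fin.last m) k
      = - (X.charpoly.coeff k * v i) := by
    rw [coeffMat_apply, adjCoeff_pred X v (by simp)]
    simp [companionMat]; ring
  have hin : ∀ l : Fin m, companionMat (m + 1) X.charpoly l.castSucc k
      = if (k : ℕ) = l + 1 then 1 else 0 := fun l => by
    simp [companionMat, l.isLt.ne]
  rw [hlast]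
  simp only [hin, mul_ite, mul_one, mul_zero]
  cases k using Fin.cases with
  | zero =>
    simp [mulVec_adjCoeff_zero]
  | succ k =>
    simp only [Fin.val_succ, add_left_inj, ← Fin.ext_iff, Finset.sum_ite_eq, Finset.mem_univ,
      if_true, coeffMat_apply, Fin.val_castSucc, mulVec_adjCoeff_succ]
    simp [sub_eq_add_neg]

end CoeffMat

/-! ### Lyapunov and Riccati equations -/

section Quadratic
open Matrix

theorem posSemidef_iff_real {ι : Type*} [Fintype ι] (P : Matrix ι ι ℝ) :
    P.PosSemidef ↔ Pᵀ = P ∧ ∀ x : ι → ℝ, 0 ≤ x ⬝ᵥ P *ᵥ x := by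
  rw [Matrix.posSemidef_iff_dotProduct_mulVec]
  simp [Matrix.IsHermitian, Matrix.conjTranspose_eq_transpose_of_trivial]

theorem Matrix.PosSemidef.transpose_eq {ι : Type*} [Fintype ι] {P : Matrix ι ι ℝ}
    (hP : P.PosSemidef) : Pᵀ = P :=
  ((posSemidef_iff_real P).1 hP).1

theorem Matrix.PosSemidef.quad_nonneg {ι : Type*} [Fintype ι] {P : Matrix ι ι ℝ}
    (hP : P.PosSemidef) (x : ι → ℝ) : 0 ≤ x ⬝ᵥ P *ᵥ x :=
  ((posSemidef_iff_real P).1 hP).2 x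

theorem Matrix.PosSemidef.transpose_mul_mul {ι κ : Type*} [Fintype ι] [Fintype κ]
    {P : Matrix ι ι ℝ} (hP : P.PosSemidef) (B : Matrix ι κ ℝ) : (Bᵀ * P * B).PosSemidef := by
  simpa [Matrix.conjTranspose_eq_transpose_of_trivial] using hP.conjTranspose_mul_mul_same B

theorem Matrix.PosSemidef.mulVec_eq_zero {ι : Type*} [Fintype ι] {P : Matrix ι ι ℝ}
    (hP : P.PosSemidef) {x : ι → ℝ} (h : x ⬝ᵥ P *ᵥ x = 0) : P *ᵥ x = 0 :=
  (hP.dotProduct_mulVec_zero_iff x).1 (by simpa using h)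

theorem Matrix.PosDef.eq_zero_of_quad_eq_zero {ι : Type*} [Fintype ι] {R : Matrix ι ι ℝ}
    (hR : R.PosDef) {x : ι → ℝ} (h : x ⬝ᵥ R *ᵥ x = 0) : x = 0 := by
  by_contra hx
  have := hR.dotProduct_mulVec_pos hx
  simp only [star_trivial] at this
  exact this.ne' h

theorem dotProduct_transpose_mul_mul_mulVec {ι ι' κ κ' : Type*} [Fintype ι] [Fintype ι']
    [Fintype κ] [Fintype κ'] (G : Matrix ι κ ℝ) (P : Matrix ι ι' ℝ) (F : Matrix ι' κ' ℝ)
    (a : κ → ℝ) (b : κ' → ℝ) :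
    a ⬝ᵥ ((Gᵀ * P * F) *ᵥ b) = (G *ᵥ a) ⬝ᵥ (P *ᵥ (F *ᵥ b)) := by
  rw [← Matrix.mulVec_mulVec, ← Matrix.mulVec_mulVec, Matrix.dotProduct_mulVec,
    Matrix.vecMul_transpose]

theorem quad_smul_add_smul {ι : Type*} [Fintype ι] (P : Matrix ι ι ℝ)
    (α β : ℝ) (a b : ι → ℝ) :
    (α • a - β • b) ⬝ᵥ P *ᵥ (α • a - β • b) + (β • a + α • b) ⬝ᵥ P *ᵥ (β • a + α • b)
      = (α ^ 2 + β ^ 2) * (a ⬝ᵥ P *ᵥ a + b ⬝ᵥ P *ᵥ b) := by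
  simp only [Matrix.mulVec_add, Matrix.mulVec_sub, Matrix.mulVec_smul, dotProduct_add,
    dotProduct_sub, add_dotProduct, sub_dotProduct, smul_dotProduct, dotProduct_smul, smul_eq_mul]
  ring

theorem eq_zero_of_posSemidef_of_neg {ι : Type*} [Fintype ι] [DecidableEq ι] {D : Matrix ι ι ℝ}
    (h1 : D.PosSemidef) (h2 : (-D).PosSemidef) : D = 0 := by
  refine Matrix.ext_of_mulVec_single fun i => ?_
  rw [Matrix.zero_mulVec]
  refine h1.mulVec_eq_zero (le_antisymm ?_ (h1.quad_nonneg _))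
  have := h2.quad_nonneg (Pi.single i 1)
  rw [Matrix.neg_mulVec, dotProduct_neg] at this
  linarith

theorem tendsto_quad_zero {ι : Type*} [Fintype ι] (P : Matrix ι ι ℝ) {w : ℕ → ι → ℝ}
    (h : Tendsto w atTop (𝓝 0)) : Tendsto (fun k => w k ⬝ᵥ P *ᵥ w k) atTop (𝓝 0) := by
  have hc : Continuous fun v : ι → ℝ => v ⬝ᵥ P *ᵥ v := by fun_prop
  simpa [Function.comp_def] using (hc.tendsto 0).comp h

theorem quad_eq_of_lyapunov {ι : Type*} [Fintype ι] {F P W : Matrix ι ι ℝ}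
    (h : P = Fᵀ * P * F + W) (x : ι → ℝ) :
    x ⬝ᵥ P *ᵥ x = (F *ᵥ x) ⬝ᵥ P *ᵥ (F *ᵥ x) + x ⬝ᵥ W *ᵥ x := by
  rw [← dotProduct_transpose_mul_mul_mulVec, ← dotProduct_add, ← Matrix.add_mulVec, ← h]

/-- A decreasing sequence of positive semi-definite matrices converges. -/
theorem exists_tendsto_of_posSemidef_antitone {ι : Type*} [Fintype ι] [DecidableEq ι]
    {P : ℕ → Matrix ι ι ℝ} (h0 : ∀ j, (P j).PosSemidef)
    (hmono : ∀ j, (P j - P (j + 1)).PosSemidef) :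
    ∃ Pinf : Matrix ι ι ℝ, Tendsto P atTop (𝓝 Pinf) ∧ Pinf.PosSemidef := by
  have hq : ∀ x : ι → ℝ, ∃ l, Tendsto (fun j => x ⬝ᵥ P j *ᵥ x) atTop (𝓝 l) := fun x =>
    ⟨_, tendsto_atTop_ciInf (antitone_nat_of_succ_le fun j => by
      have := (hmono j).quad_nonneg x
      rw [Matrix.sub_mulVec, dotProduct_sub] at this
      linarith) ⟨0, by rintro _ ⟨j, rfl⟩; exact (h0 j).quad_nonneg x⟩⟩
  choose q hq using hq
  -- Polarization: the entries are combinations of values of the quadratic form, each of which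
  -- decreases and is bounded below by zero.
  have hent : ∀ j a b, P j a b = ((Pi.single a 1 + Pi.single b 1) ⬝ᵥ
      P j *ᵥ (Pi.single a 1 + Pi.single b 1) - Pi.single a 1 ⬝ᵥ P j *ᵥ Pi.single a 1
        - Pi.single b 1 ⬝ᵥ P j *ᵥ Pi.single b 1) / 2 := by
    intro j a b
    have hs : P j b a = P j a b := congrFun (congrFun (h0 j).transpose_eq a) b
    simp [Matrix.mulVec_add, add_dotProduct, dotProduct_add, hs]
    ring
  have ht : Tendsto P atTop (𝓝 (Matrix.of fun a b =>
      (q (Pi.single a 1 + Pi.single b 1) - q (Pi.single a 1) - q (Pi.single b 1)) / 2)) := by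
    refine tendsto_pi_nhds.2 fun a => tendsto_pi_nhds.2 fun b => ?_
    simp only [hent]
    exact (((hq _).sub (hq _)).sub (hq _)).div_const 2
  refine ⟨_, ht, (posSemidef_iff_real _).2 ⟨?_, fun x => ?_⟩⟩
  · have hc : Continuous fun Z : Matrix ι ι ℝ => Zᵀ := by fun_prop
    refine tendsto_nhds_unique (((hc.tendsto _).comp ht).congr fun j => ?_) ht
    exact (h0 j).transpose_eq
  · have hc : Continuous fun Z : Matrix ι ι ℝ => x ⬝ᵥ Z *ᵥ x := by fun_prop
    exact ge_of_tendsto' ((hc.tendsto _).comp ht) fun j => (h0 j).quad_nonneg x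

end Quadratic

/-! ### Lyapunov equations for Schur matrices. -/

section Lyapunov
open Matrix

variable {ι κ : Type*} [Fintype ι] [DecidableEq ι] [Fintype κ] [DecidableEq κ]

theorem IsSchur.tendsto_pow_mulVec {F : Matrix ι ι ℝ} (hF : IsSchur F) (w : ι → ℝ) :
    Tendsto (fun k => F ^ k *ᵥ w) atTop (𝓝 0) := by
  have hc : Continuous fun Z : Matrix ι ι ℝ => Z *ᵥ w := by fun_prop
  simpa [Function.comp_def] using (hc.tendsto 0).comp hF.tendsto_pow

/-- Lyapunov's criterion with detectability: along a real eigenplane of `F` on or outside the unit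
circle, the defect `W` of the Lyapunov function vanishes. -/
theorem isSchur_of_lyapunov {F P W : Matrix ι ι ℝ} (hP : P.PosSemidef) (hW : W.PosSemidef)
    (h : P = Fᵀ * P * F + W)
    (hdet : ∀ (α β : ℝ) (a b : ι → ℝ), F *ᵥ a = α • a - β • b → F *ᵥ b = β • a + α • b →
      1 ≤ α ^ 2 + β ^ 2 → a ⬝ᵥ W *ᵥ a = 0 → b ⬝ᵥ W *ᵥ b = 0 → a = 0 ∧ b = 0) :
    IsSchur F := by
  rw [isSchur_iff_real]
  intro α β a b ha hb hab
  have h1 := quad_eq_of_lyapunov h a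
  have h2 := quad_eq_of_lyapunov h b
  have h3 := quad_smul_add_smul P α β a b
  rw [ha] at h1
  rw [hb] at h2
  have := hP.quad_nonneg a
  have := hP.quad_nonneg b
  have := hW.quad_nonneg a
  have := hW.quad_nonneg b
  -- Adding the Lyapunov identities at `a` and `b` gives `(|μ|² - 1)(P(a) + P(b)) + W(a) + W(b) =
  -- 0`, a sum of nonnegative terms.
  have h4 : 0 ≤ (α ^ 2 + β ^ 2 - 1) * (a ⬝ᵥ P *ᵥ a + b ⬝ᵥ P *ᵥ b) :=
    mul_nonneg (by linarith) (by linarith)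
  exact hdet α β a b ha hb hab (by linarith) (by linarith)

theorem eq_zero_of_eq_transpose_mul_mul {F X : Matrix ι ι ℝ} (hF : IsSchur F)
    (h : X = Fᵀ * X * F) : X = 0 := by
  have hk : ∀ k, X = (F ^ k)ᵀ * X * F ^ k := by
    intro k
    induction k with
    | zero => simp
    | succ k ih =>
      conv_lhs => rw [h, ih]
      rw [pow_succ, Matrix.transpose_mul]
      simp only [Matrix.mul_assoc]
  have hc : Continuous fun Z : Matrix ι ι ℝ => Zᵀ * X * Z := by fun_prop
  have ht := (hc.tendsto 0).comp hF.tendsto_pow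
  simp only [Matrix.mul_zero] at ht
  exact tendsto_nhds_unique (tendsto_const_nhds.congr hk) ht

theorem lyapunov_unique {F W X Y : Matrix ι ι ℝ} (hF : IsSchur F)
    (hX : X = Fᵀ * X * F + W) (hY : Y = Fᵀ * Y * F + W) : X = Y := by
  refine sub_eq_zero.1 (eq_zero_of_eq_transpose_mul_mul hF ?_)
  rw [Matrix.mul_sub, Matrix.sub_mul]
  nth_rewrite 1 [hX, hY]
  abel

/-- The linear map `X ↦ X - Fᵀ X F` is injective on a finite-dimensional space, hence surjective. -/
theorem exists_lyapunov {F : Matrix ι ι ℝ} (hF : IsSchur F) (W : Matrix ι ι ℝ) :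
    ∃ X, X = Fᵀ * X * F + W := by
  let T : Matrix ι ι ℝ →ₗ[ℝ] Matrix ι ι ℝ :=
    { toFun := fun X => X - Fᵀ * X * F
      map_add' := fun X Y => by rw [Matrix.mul_add, Matrix.add_mul]; abel
      map_smul' := fun c X => by simp [smul_sub] }
  have hinj : Function.Injective T := (injective_iff_map_eq_zero T).2 fun X hX =>
    eq_zero_of_eq_transpose_mul_mul hF (sub_eq_zero.1 hX)
  obtain ⟨X, hX⟩ := (LinearMap.injective_iff_surjective.1 hinj) W
  exact ⟨X, by rw [← hX]; exact (add_sub_cancel _ _).symm⟩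

theorem transpose_eq_of_lyapunov {F W X : Matrix ι ι ℝ} (hF : IsSchur F) (hW : Wᵀ = W)
    (hX : X = Fᵀ * X * F + W) : Xᵀ = X := by
  refine lyapunov_unique hF (W := W) ?_ hX
  nth_rewrite 1 [hX]
  rw [Matrix.transpose_add, hW, Matrix.transpose_mul, Matrix.transpose_mul,
    Matrix.transpose_transpose, Matrix.mul_assoc]

/-- The form `xᵀ X x` does not increase along the orbits of `F`, and these tend to zero. -/
theorem posSemidef_of_lyapunov {F W X : Matrix ι ι ℝ} (hF : IsSchur F) (hW : W.PosSemidef)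
    (hX : X = Fᵀ * X * F + W) : X.PosSemidef := by
  refine (posSemidef_iff_real X).2 ⟨transpose_eq_of_lyapunov hF hW.transpose_eq hX, fun x => ?_⟩
  have hk : ∀ k, (F ^ k *ᵥ x) ⬝ᵥ X *ᵥ (F ^ k *ᵥ x) ≤ x ⬝ᵥ X *ᵥ x := by
    intro k
    induction k with
    | zero => simp
    | succ k ih =>
      refine le_trans ?_ ih
      set z := F ^ k *ᵥ x
      rw [pow_succ', ← Matrix.mulVec_mulVec]
      linarith [hW.quad_nonneg z, quad_eq_of_lyapunov hX z]
  exact le_of_tendsto' (tendsto_quad_zero X (hF.tendsto_pow_mulVec x)) hk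

theorem posSemidef_sub_of_lyapunov {F W W' X Y : Matrix ι ι ℝ} (hF : IsSchur F)
    (hW : (W - W').PosSemidef) (hX : X = Fᵀ * X * F + W) (hY : Y = Fᵀ * Y * F + W') :
    (X - Y).PosSemidef := by
  refine posSemidef_of_lyapunov hF hW ?_
  rw [Matrix.mul_sub, Matrix.sub_mul]
  nth_rewrite 1 [hX, hY]
  abel

end Lyapunov


/-! ### Policy iteration for a known linear system. -/

section PolicyIteration
open Matrix

/-- `P` is the cost matrix of the state feedback `u = -K x` for the plant `(A, B)` and the
weights `Q`, `R`. -/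
def IsCost {ι κ : Type*} [Fintype ι] [Fintype κ] (A : Matrix ι ι ℝ) (B : Matrix ι κ ℝ)
    (Q : Matrix ι ι ℝ) (R : Matrix κ κ ℝ) (K : Matrix κ ι ℝ) (P : Matrix ι ι ℝ) : Prop :=
  P = (A - B * K)ᵀ * P * (A - B * K) + (Q + Kᵀ * R * K)

/-- The gain that is greedy for the cost matrix `P`. -/
noncomputable def greedyGain {ι κ : Type*} [Fintype ι] [Fintype κ] [DecidableEq κ]
    (A : Matrix ι ι ℝ) (B : Matrix ι κ ℝ) (R : Matrix κ κ ℝ) (P : Matrix ι ι ℝ) : Matrix κ ι ℝ :=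
  (R + Bᵀ * P * B)⁻¹ * (Bᵀ * P * A)

variable {ι κ : Type*} [Fintype ι] [Fintype κ] [DecidableEq κ]
  {A : Matrix ι ι ℝ} {B : Matrix ι κ ℝ} {Q : Matrix ι ι ℝ} {R : Matrix κ κ ℝ} {P : Matrix ι ι ℝ}

theorem isUnit_det_add_transpose_mul_mul (hR : R.PosDef) (hP : P.PosSemidef) :
    IsUnit (R + Bᵀ * P * B).det :=
  (Matrix.isUnit_iff_isUnit_det _).1 (hR.add_posSemidef (hP.transpose_mul_mul B)).isUnit

theorem mul_greedyGain (hR : R.PosDef) (hP : P.PosSemidef) :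
    (R + Bᵀ * P * B) * greedyGain A B R P = Bᵀ * P * A := by
  rw [greedyGain, ← Matrix.mul_assoc,
    Matrix.mul_nonsing_inv _ (isUnit_det_add_transpose_mul_mul hR hP), Matrix.one_mul]

/-- Completion of squares. -/
theorem closedLoop_cost_eq (hR : R.PosDef) (hP : P.PosSemidef) (K : Matrix κ ι ℝ) :
    (A - B * K)ᵀ * P * (A - B * K) + Kᵀ * R * K
      = Aᵀ * P * A + (K - greedyGain A B R P)ᵀ * (R + Bᵀ * P * B) * (K - greedyGain A B R P)
        - (greedyGain A B R P)ᵀ * (R + Bᵀ * P * B) * greedyGain A B R P := by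
  have h1 := mul_greedyGain (A := A) (B := B) hR hP
  have h2 : (greedyGain A B R P)ᵀ * (R + Bᵀ * P * B) = Aᵀ * P * B := by
    have := congrArg Matrix.transpose h1
    simpa [Matrix.transpose_mul, hP.transpose_eq, hR.posSemidef.transpose_eq,
      Matrix.mul_assoc] using this
  generalize greedyGain A B R P = G at h1 h2 ⊢
  have e1 : (K - G)ᵀ * (R + Bᵀ * P * B) * (K - G) - Gᵀ * (R + Bᵀ * P * B) * G
      = Kᵀ * (R + Bᵀ * P * B) * K - Kᵀ * (Bᵀ * P * A) - Aᵀ * P * B * K := by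
    rw [← h1, ← h2, Matrix.transpose_sub]
    simp only [Matrix.sub_mul, Matrix.mul_sub, Matrix.mul_assoc]
    abel
  rw [add_sub_assoc, e1]
  simp only [Matrix.transpose_sub, Matrix.transpose_mul, Matrix.sub_mul, Matrix.mul_sub,
    Matrix.add_mul, Matrix.mul_add, Matrix.mul_assoc]
  abel

/-- Completing squares at `K` and at the greedy gain `G` shows that the cost of `K` is also a
Lyapunov function for `A - B G`, with the square of `K - G` as surplus. Both stability of `G` and
decrease of the cost follow from this identity. -/
theorem isCost_greedyGain_lyapunov (hR : R.PosDef) (hP : P.PosSemidef) {K : Matrix κ ι ℝ}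
    (h : IsCost A B Q R K P) :
    P = (A - B * greedyGain A B R P)ᵀ * P * (A - B * greedyGain A B R P)
      + (Q + (greedyGain A B R P)ᵀ * R * greedyGain A B R P
        + (K - greedyGain A B R P)ᵀ * (R + Bᵀ * P * B) * (K - greedyGain A B R P)) := by
  have h1 := closedLoop_cost_eq (A := A) (B := B) hR hP K
  have h2 := closedLoop_cost_eq (A := A) (B := B) hR hP (greedyGain A B R P)
  rw [sub_self, Matrix.transpose_zero, Matrix.zero_mul, Matrix.zero_mul, add_zero] at h2
  have h3 : (A - B * K)ᵀ * P * (A - B * K) + Kᵀ * R * K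
      = (A - B * greedyGain A B R P)ᵀ * P * (A - B * greedyGain A B R P)
        + (greedyGain A B R P)ᵀ * R * greedyGain A B R P
        + (K - greedyGain A B R P)ᵀ * (R + Bᵀ * P * B) * (K - greedyGain A B R P) := by
    rw [h1, h2]; abel
  conv_lhs => rw [h, add_left_comm, h3]
  abel

/-- The Riccati equation says that `P` is the cost of its greedy gain. -/
theorem isCost_greedyGain_iff (hR : R.PosDef) (hP : P.PosSemidef) :
    IsCost A B Q R (greedyGain A B R P) P ↔
      Aᵀ * P * A - P + Q - Aᵀ * P * B * (R + Bᵀ * P * B)⁻¹ * Bᵀ * P * A = 0 := by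
  have h2 := closedLoop_cost_eq (A := A) (B := B) hR hP (greedyGain A B R P)
  rw [sub_self, Matrix.transpose_zero, Matrix.zero_mul, Matrix.zero_mul, add_zero] at h2
  have h3 : (greedyGain A B R P)ᵀ * (R + Bᵀ * P * B) * greedyGain A B R P
      = Aᵀ * P * B * (R + Bᵀ * P * B)⁻¹ * Bᵀ * P * A := by
    have h4 : (R + Bᵀ * P * B)ᵀ = R + Bᵀ * P * B := by
      rw [Matrix.transpose_add, hR.posSemidef.transpose_eq, (hP.transpose_mul_mul B).transpose_eq]
    rw [Matrix.mul_assoc, mul_greedyGain hR hP, greedyGain, Matrix.transpose_mul,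
      Matrix.transpose_nonsing_inv, h4]
    simp only [Matrix.transpose_mul, Matrix.transpose_transpose, hP.transpose_eq,
      Matrix.mul_assoc]
  rw [IsCost, add_left_comm, h2, h3, eq_comm, ← sub_eq_zero]
  refine Eq.congr ?_ rfl
  abel

theorem tendsto_greedyGain {Pj : ℕ → Matrix ι ι ℝ} (hR : R.PosDef) (hP : P.PosSemidef)
    (h : Tendsto Pj atTop (𝓝 P)) :
    Tendsto (fun j => greedyGain A B R (Pj j)) atTop (𝓝 (greedyGain A B R P)) := by
  have hdet : (R + Bᵀ * P * B).det ≠ 0 := (isUnit_det_add_transpose_mul_mul hR hP).ne_zero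
  simp only [greedyGain, Matrix.inv_def, Ring.inverse_eq_inv']
  have c1 : Continuous fun Z : Matrix ι ι ℝ => (R + Bᵀ * Z * B).det := by fun_prop
  have c2 : Continuous fun Z : Matrix ι ι ℝ => (R + Bᵀ * Z * B).adjugate :=
    Continuous.matrix_adjugate (by fun_prop)
  have c3 : Continuous fun Z : Matrix ι ι ℝ => Bᵀ * Z * A := by fun_prop
  have t1 := ((c1.tendsto P).comp h).inv₀ hdet
  have t2 := t1.smul ((c2.tendsto P).comp h)
  have c4 : Continuous fun q : Matrix κ κ ℝ × Matrix κ ι ℝ => q.1 * q.2 := by fun_prop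
  exact (c4.tendsto _).comp (t2.prodMk_nhds ((c3.tendsto P).comp h))

variable [DecidableEq ι]

/-- A greedy gain of the cost of a stabilizing gain is stabilizing. -/
theorem isSchur_greedyGain (hQ : Q.PosSemidef) (hR : R.PosDef) {K : Matrix κ ι ℝ}
    (hK : IsSchur (A - B * K)) (hP : P.PosSemidef) (h : IsCost A B Q R K P) :
    IsSchur (A - B * greedyGain A B R P) := by
  have hG := hR.add_posSemidef (hP.transpose_mul_mul B)
  have hW1 := hQ.add (hR.posSemidef.transpose_mul_mul (greedyGain A B R P))
  have hW2 := hG.posSemidef.transpose_mul_mul (K - greedyGain A B R P)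
  refine isSchur_of_lyapunov hP (hW1.add hW2) (isCost_greedyGain_lyapunov hR hP h) ?_
  intro α β a b ha hb hab hWa hWb
  -- Where the weight vanishes so does the surplus, hence `K x = G x` and the two closed loops
  -- agree. Stability of `A - B K` then takes the role of an observability assumption.
  have hx : ∀ x : ι → ℝ, x ⬝ᵥ (Q + (greedyGain A B R P)ᵀ * R * greedyGain A B R P
        + (K - greedyGain A B R P)ᵀ * (R + Bᵀ * P * B) * (K - greedyGain A B R P)) *ᵥ x = 0 →
      (A - B * K) *ᵥ x = (A - B * greedyGain A B R P) *ᵥ x := by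
    intro x hx
    rw [Matrix.add_mulVec, dotProduct_add] at hx
    have h1 := hW1.quad_nonneg x
    have h2 := hW2.quad_nonneg x
    have h3 := le_antisymm (by linarith) h2
    rw [dotProduct_transpose_mul_mul_mulVec] at h3
    have h4 := hG.eq_zero_of_quad_eq_zero h3
    rw [Matrix.sub_mulVec, sub_eq_zero] at h4
    rw [Matrix.sub_mulVec, Matrix.sub_mulVec, ← Matrix.mulVec_mulVec, ← Matrix.mulVec_mulVec, h4]
  exact (isSchur_iff_real _).1 hK α β a b (by rw [hx a hWa, ha]) (by rw [hx b hWb, hb]) hab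

theorem isCost_posSemidef {ι κ : Type*} [Fintype ι] [DecidableEq ι] [Fintype κ]
    {A : Matrix ι ι ℝ} {B : Matrix ι κ ℝ} {Q : Matrix ι ι ℝ} {R : Matrix κ κ ℝ} {P : Matrix ι ι ℝ}
    (hQ : Q.PosSemidef) (hR : R.PosDef) {K : Matrix κ ι ℝ}
    (hK : IsSchur (A - B * K)) (h : IsCost A B Q R K P) : P.PosSemidef :=
  posSemidef_of_lyapunov hK (hQ.add (hR.posSemidef.transpose_mul_mul K)) h

/-- No stabilizing gain has a smaller cost than a solution of the Riccati equation, and a greedy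
step decreases the cost. -/
theorem posSemidef_cost_sub_greedy_cost (hR : R.PosDef) {K : Matrix κ ι ℝ}
    (hP : P.PosSemidef) (h : IsCost A B Q R K P) {P' : Matrix ι ι ℝ}
    (hK' : IsSchur (A - B * greedyGain A B R P)) (h' : IsCost A B Q R (greedyGain A B R P) P') :
    (P - P').PosSemidef := by
  refine posSemidef_sub_of_lyapunov hK' ?_ (isCost_greedyGain_lyapunov hR hP h) h'
  rw [add_sub_cancel_left]
  exact (hR.add_posSemidef (hP.transpose_mul_mul B)).posSemidef.transpose_mul_mul _

/-- By completion of squares, `P'` solves the Lyapunov equation of `A - B K` with the weight of `K`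
reduced by a square. Only `K` has to be stabilizing. -/
theorem posSemidef_cost_sub_riccati (hR : R.PosDef) {K : Matrix κ ι ℝ}
    (hK : IsSchur (A - B * K)) (h : IsCost A B Q R K P) {P' : Matrix ι ι ℝ}
    (hP' : P'.PosSemidef) (h' : IsCost A B Q R (greedyGain A B R P') P') :
    (P - P').PosSemidef := by
  have h1 := closedLoop_cost_eq (A := A) (B := B) hR hP' K
  have h2 := closedLoop_cost_eq (A := A) (B := B) hR hP' (greedyGain A B R P')
  rw [sub_self, Matrix.transpose_zero, Matrix.zero_mul, Matrix.zero_mul, add_zero] at h2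
  refine posSemidef_sub_of_lyapunov hK (W' := Q + Kᵀ * R * K
    - (K - greedyGain A B R P')ᵀ * (R + Bᵀ * P' * B) * (K - greedyGain A B R P')) ?_ h ?_
  · rw [sub_sub_cancel]
    exact (hR.add_posSemidef (hP'.transpose_mul_mul B)).posSemidef.transpose_mul_mul _
  · rw [IsCost, add_left_comm, h2] at h'
    rw [add_sub_assoc, add_left_comm, ← add_sub_assoc, h1]
    conv_lhs => rw [h']
    abel

/-- Each solution is the cost of a stabilizing gain, so each dominates the other. -/
theorem riccati_unique (hR : R.PosDef) {P' : Matrix ι ι ℝ}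
    (hP : P.PosSemidef) (h : IsCost A B Q R (greedyGain A B R P) P)
    (hK : IsSchur (A - B * greedyGain A B R P))
    (hP' : P'.PosSemidef) (h' : IsCost A B Q R (greedyGain A B R P') P')
    (hK' : IsSchur (A - B * greedyGain A B R P')) : P = P' := by
  refine sub_eq_zero.1 (eq_zero_of_posSemidef_of_neg
    (posSemidef_cost_sub_riccati hR hK h hP' h') ?_)
  rw [neg_sub]
  exact posSemidef_cost_sub_riccati hR hK' h' hP h

/-- The cost from a state whose free motion is unobserved and tends to zero is zero. -/
theorem riccati_mulVec_eq_zero (hR : R.PosDef)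
    (hP : P.PosSemidef) (h : IsCost A B Q R (greedyGain A B R P) P) {w : ι → ℝ}
    (hw : ∀ k, (A ^ k *ᵥ w) ⬝ᵥ Q *ᵥ (A ^ k *ᵥ w) = 0)
    (hlim : Tendsto (fun k => A ^ k *ᵥ w) atTop (𝓝 0)) : P *ᵥ w = 0 := by
  have h2 := closedLoop_cost_eq (A := A) (B := B) hR hP (greedyGain A B R P)
  rw [sub_self, Matrix.transpose_zero, Matrix.zero_mul, Matrix.zero_mul, add_zero] at h2
  rw [IsCost, add_left_comm, h2] at h
  have hG := (hR.add_posSemidef (hP.transpose_mul_mul B)).posSemidef.transpose_mul_mul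
    (greedyGain A B R P)
  -- Dropping the subtracted square gives `P ≤ Aᵀ P A + Q`: applying zero input for one step is
  -- never better than optimal.
  have hstep : P = Aᵀ * P * A
      + (Q - (greedyGain A B R P)ᵀ * (R + Bᵀ * P * B) * greedyGain A B R P) := by
    conv_lhs => rw [h]
    abel
  have hle : ∀ k, w ⬝ᵥ P *ᵥ w ≤ (A ^ k *ᵥ w) ⬝ᵥ P *ᵥ (A ^ k *ᵥ w) := by
    intro k
    induction k with
    | zero => simp
    | succ k ih =>
      refine ih.trans ?_
      have h3 := quad_eq_of_lyapunov hstep (A ^ k *ᵥ w)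
      rw [Matrix.sub_mulVec, dotProduct_sub, hw k] at h3
      rw [pow_succ', ← Matrix.mulVec_mulVec]
      linarith [hG.quad_nonneg (A ^ k *ᵥ w)]
  exact hP.mulVec_eq_zero (le_antisymm
    (ge_of_tendsto' (tendsto_quad_zero P hlim) hle) (hP.quad_nonneg w))

/-- Convergence of policy iteration from a stabilizing gain. -/
theorem policyIteration_tendsto (hQ : Q.PosSemidef) (hR : R.PosDef)
    {K : ℕ → Matrix κ ι ℝ} {Pj : ℕ → Matrix ι ι ℝ} (h0 : IsSchur (A - B * K 0))
    (hcost : ∀ j, IsCost A B Q R (K j) (Pj j)) (hK : ∀ j, K (j + 1) = greedyGain A B R (Pj j)) :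
    ∃ Pinf : Matrix ι ι ℝ, Pinf.PosSemidef ∧ IsCost A B Q R (greedyGain A B R Pinf) Pinf ∧
      Tendsto K atTop (𝓝 (greedyGain A B R Pinf)) := by
  have hS : ∀ j, IsSchur (A - B * K j) := by
    intro j
    induction j with
    | zero => exact h0
    | succ j ih =>
      rw [hK]
      exact isSchur_greedyGain hQ hR ih (isCost_posSemidef hQ hR ih (hcost j)) (hcost j)
  have hP : ∀ j, (Pj j).PosSemidef := fun j => isCost_posSemidef hQ hR (hS j) (hcost j)
  obtain ⟨Pinf, hlim, hpsd⟩ := exists_tendsto_of_posSemidef_antitone hP fun j =>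
    posSemidef_cost_sub_greedy_cost hR (hP j) (hcost j) (hK j ▸ hS (j + 1)) (hK j ▸ hcost (j + 1))
  have hKlim : Tendsto K atTop (𝓝 (greedyGain A B R Pinf)) := by
    rw [← tendsto_add_atTop_iff_nat 1]
    simp only [hK]
    exact tendsto_greedyGain hR hpsd hlim
  refine ⟨Pinf, hpsd, ?_, hKlim⟩
  have hc : Continuous fun q : Matrix ι ι ℝ × Matrix κ ι ℝ =>
      (A - B * q.2)ᵀ * q.1 * (A - B * q.2) + (Q + q.2ᵀ * R * q.2) := by fun_prop
  -- Passing to the limit in the cost equation yields the Riccati equation, as the limit gain is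
  -- greedy for the limit cost. Stability need not survive the limit and is not claimed.
  have ht := (hc.tendsto (Pinf, greedyGain A B R Pinf)).comp (hlim.prodMk_nhds hKlim)
  exact tendsto_nhds_unique (hlim.congr hcost) ht

end PolicyIteration

/-! ### The learning equation -/

section Learning
open Matrix

/-- Group the terms of the quadratic form by unordered pairs. Symmetry of `P` is not needed, because
`vech` averages mirror entries. -/
theorem deltaSym_dotProduct_vech {ι : Type*} [Fintype ι] [DecidableEq ι] (v : ι → ℝ)
    (P : Matrix ι ι ℝ) : deltaSym v ⬝ᵥ vech P = v ⬝ᵥ P *ᵥ v := by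
  have h1 : v ⬝ᵥ P *ᵥ v = ∑ q : ι × ι, v q.1 * v q.2 * P q.1 q.2 := by
    simp only [dotProduct, Matrix.mulVec, Finset.mul_sum, Fintype.sum_prod_type]
    exact Finset.sum_congr rfl fun i _ => Finset.sum_congr rfl fun j _ => by ring
  rw [h1, ← Finset.sum_fiberwise (s := Finset.univ) (g := fun q : ι × ι => s(q.1, q.2)),
    dotProduct]
  refine Finset.sum_congr rfl fun s _ => ?_
  induction s with
  | h i j =>
    have hd : deltaSym v s(i, j) * vech P s(i, j)
        = (2 * (v i * v j) - if i = j then v i ^ 2 else 0) * ((P i j + P j i) / 2) := by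
      simp only [deltaSym, vech, Sym2.lift_mk, Matrix.diagonal_pow, Matrix.sub_apply,
        Matrix.smul_apply, Matrix.vecMulVec_apply, Matrix.diagonal_apply, smul_eq_mul,
        Pi.pow_apply]
      by_cases hij : i = j
      · subst hij
        simp
      · simp only [hij, Ne.symm hij, if_false]
        ring
    have hf : (Finset.univ.filter fun q : ι × ι => s(q.1, q.2) = s(i, j))
        = {(i, j), (j, i)} := by
      ext ⟨a, b⟩
      simp
    rw [hd, hf]
    by_cases hij : i = j
    · subst hij
      simp only [if_true, Finset.insert_eq_of_mem (Finset.mem_singleton_self _),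
        Finset.sum_singleton]
      ring
    · rw [Finset.sum_pair (by simp [hij]), if_neg hij]
      ring

theorem deltaPair_dotProduct_vec {ι κ : Type*} [Fintype ι] [Fintype κ] (v : ι → ℝ) (w : κ → ℝ)
    (P : Matrix ι κ ℝ) : deltaPair v w ⬝ᵥ P.vec = v ⬝ᵥ P *ᵥ w := by
  simp only [dotProduct, deltaPair, Matrix.mulVec, Finset.mul_sum, Fintype.sum_prod_type,
    Matrix.vec]
  rw [Finset.sum_comm]
  exact Finset.sum_congr rfl fun i _ => Finset.sum_congr rfl fun j _ => by ring

theorem eq_zero_of_vech_eq_zero {ι : Type*} {Z : Matrix ι ι ℝ} (hZ : Zᵀ = Z) (h : vech Z = 0) :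
    Z = 0 := by
  ext i j
  have h1 := congrFun h s(i, j)
  have h2 : Z j i = Z i j := congrFun (congrFun hZ i) j
  simp only [vech, Sym2.lift_mk, h2, Pi.zero_apply] at h1
  rw [Matrix.zero_apply]
  linarith

theorem mulVec_injective_of_rank_eq_card {μ ν : Type*} [Fintype μ] [Fintype ν]
    {X : Matrix μ ν ℝ} (h : X.rank = Fintype.card ν) {z : ν → ℝ} (hz : X *ᵥ z = 0) : z = 0 := by
  have h1 := LinearMap.finrank_range_add_finrank_ker X.mulVecLin
  rw [Module.finrank_fintype_fun_eq_card] at h1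
  have h2 : Module.finrank ℝ (LinearMap.ker X.mulVecLin) = 0 := by
    rw [Matrix.rank] at h
    omega
  rw [Submodule.finrank_eq_zero] at h2
  have : z ∈ LinearMap.ker X.mulVecLin := hz
  rwa [h2] at this

/-- Identifies the rank condition as full column rank of `Π`. -/
theorem card_dataPi_columns (ι : Type*) [Fintype ι] (m : ℕ) :
    Fintype.card (Sym2 ι ⊕ (Fin m × ι) ⊕ Sym2 (Fin m))
      = (Fintype.card ι + m) * (Fintype.card ι + m + 1) / 2 := by
  simp only [Fintype.card_sum, Fintype.card_prod, Sym2.card, Fintype.card_fin, Nat.choose_two_right,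
    Nat.add_sub_cancel]
  generalize Fintype.card ι = a
  -- The halves are natural-number divisions, so evenness has to be supplied.
  have ha : 2 ∣ (a + 1) * a := by
    rw [mul_comm]; exact (Nat.even_mul_succ_self a).two_dvd
  have hm : 2 ∣ (m + 1) * m := by
    rw [mul_comm]; exact (Nat.even_mul_succ_self m).two_dvd
  obtain ⟨r, hr⟩ := ha
  obtain ⟨s, hs⟩ := hm
  have : (a + m) * (a + m + 1) = 2 * (r + (m * a + s)) := by
    linear_combination hr + hs
  rw [hr, hs, this]
  simp

variable {ι : Type*} [Fintype ι] [DecidableEq ι] {m p : ℕ} {N : ℕ} {η : ℕ → ι → ℝ}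
  {u : ℕ → Fin m → ℝ} {y : ℕ → Fin p → ℝ}

/-- A quadratic form in `(η, u + K η)` that vanishes on rich data is zero. -/
theorem eq_zero_of_quad_data_eq_zero
    (hrank : (dataPi N η u).rank = (Fintype.card ι + m) * (Fintype.card ι + m + 1) / 2)
    (K : Matrix (Fin m) ι ℝ) {Z₁ : Matrix ι ι ℝ} {Z₂ : Matrix ι (Fin m) ℝ}
    {Z₃ : Matrix (Fin m) (Fin m) ℝ} (h₁ : Z₁ᵀ = Z₁) (h₃ : Z₃ᵀ = Z₃)
    (h : ∀ k : Fin (N + 1), η k ⬝ᵥ Z₁ *ᵥ η k + 2 * (η k ⬝ᵥ Z₂ *ᵥ (u k + K *ᵥ η k))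
      + (u k + K *ᵥ η k) ⬝ᵥ Z₃ *ᵥ (u k + K *ᵥ η k) = 0) :
    Z₁ = 0 ∧ Z₂ = 0 ∧ Z₃ = 0 := by
  -- Blocks of the same form in the variables `(η, u)`. As `Π` does not involve `K`, one rank
  -- condition serves all iterations.
  set Y₁ := Z₁ + Z₂ * K + (Z₂ * K)ᵀ + Kᵀ * Z₃ * K with hY₁
  set Y₂ := Z₂ + Kᵀ * Z₃ with hY₂
  have hz : dataPi N η u *ᵥ Sum.elim (vech Y₁) (Sum.elim Y₂.vec (vech Z₃)) = 0 := by
    funext k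
    have hk : (dataPi N η u *ᵥ Sum.elim (vech Y₁) (Sum.elim Y₂.vec (vech Z₃))) k
        = η k ⬝ᵥ Y₁ *ᵥ η k + 2 * (η k ⬝ᵥ Y₂ *ᵥ u k) + u k ⬝ᵥ Z₃ *ᵥ u k := by
      rw [← deltaSym_dotProduct_vech, ← deltaPair_dotProduct_vec, ← deltaSym_dotProduct_vech,
        add_assoc, ← smul_eq_mul, ← smul_dotProduct, ← sumElim_dotProduct_sumElim,
        ← sumElim_dotProduct_sumElim]
      rfl
    have e1 : η k ⬝ᵥ (Z₂ * K)ᵀ *ᵥ η k = η k ⬝ᵥ Z₂ *ᵥ K *ᵥ η k := by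
      rw [Matrix.mulVec_transpose, dotProduct_comm, ← Matrix.dotProduct_mulVec,
        Matrix.mulVec_mulVec]
    have e4 : η k ⬝ᵥ (Z₂ * K) *ᵥ η k = η k ⬝ᵥ Z₂ *ᵥ K *ᵥ η k := by
      rw [Matrix.mulVec_mulVec]
    have e2 : η k ⬝ᵥ (Kᵀ * Z₃) *ᵥ u k = (K *ᵥ η k) ⬝ᵥ Z₃ *ᵥ u k := by
      rw [← Matrix.mulVec_mulVec, Matrix.dotProduct_mulVec, Matrix.vecMul_transpose]
    have e3 : u k ⬝ᵥ Z₃ *ᵥ K *ᵥ η k = (K *ᵥ η k) ⬝ᵥ Z₃ *ᵥ u k := by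
      rw [Matrix.dotProduct_mulVec, dotProduct_comm, ← Matrix.mulVec_transpose, h₃]
    rw [hk, Pi.zero_apply, ← h k, hY₁, hY₂]
    simp only [Matrix.add_mulVec, Matrix.mulVec_add, dotProduct_add, add_dotProduct, e1, e2, e3,
      e4, dotProduct_transpose_mul_mul_mulVec]
    ring
  have h0 := mulVec_injective_of_rank_eq_card (hrank.trans (card_dataPi_columns ι m).symm) hz
  have h0₁ : vech Y₁ = 0 := funext fun s => congrFun h0 (Sum.inl s)
  have h0₂ : Y₂ = 0 := by
    ext i j
    exact congrFun h0 (Sum.inr (Sum.inl (j, i)))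
  have h0₃ : Z₃ = 0 :=
    eq_zero_of_vech_eq_zero h₃ (funext fun s => congrFun h0 (Sum.inr (Sum.inr s)))
  have h0₂' : Z₂ = 0 := by simpa [hY₂, h0₃] using h0₂
  refine ⟨eq_zero_of_vech_eq_zero h₁ ?_, h0₂', h0₃⟩
  simpa [hY₁, h0₂', h0₃] using h0₁

variable {AA : Matrix ι ι ℝ} {BB : Matrix ι (Fin m) ℝ} {CC : Matrix (Fin p) ι ℝ}
  {Q : Matrix (Fin p) (Fin p) ℝ} {R : Matrix (Fin m) (Fin m) ℝ}

/-- With rich data, the learning equation says that `P` is the cost of the gain `K`. -/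
theorem solvesLearningEq_iff (hQ : Qᵀ = Q) (hR : Rᵀ = R)
    (hrank : (dataPi N η u).rank = (Fintype.card ι + m) * (Fintype.card ι + m + 1) / 2)
    (hη : ∀ k, η (k + 1) = AA *ᵥ η k + BB *ᵥ u k) (hy : ∀ k, y k = CC *ᵥ η k)
    (K : Matrix (Fin m) ι ℝ) (P : Matrix ι ι ℝ) (PAB : Matrix ι (Fin m) ℝ)
    (PBB : Matrix (Fin m) (Fin m) ℝ) :
    SolvesLearningEq N η u y Q R K P PAB PBB ↔
      Pᵀ = P ∧ IsCost AA BB (CCᵀ * Q * CC) R K P ∧ PAB = (AA - BB * K)ᵀ * P * BB ∧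
        PBB = BBᵀ * P * BB := by
  -- Since `η(k+1) = (AA - BB K) η(k) + BB û(k)`, the residual of row `k` is a quadratic form in
  -- `(η(k), û(k))` whose blocks are the defects of the three claimed equations.
  have hrow : Pᵀ = P → ∀ k : Fin (N + 1),
      (dataPiHat N η u K *ᵥ Sum.elim (vech P) (Sum.elim PAB.vec (vech PBB))) k
        - (dataPhi N η y *ᵥ Sum.elim (vech Q) (vech (Kᵀ * R * K))) k
      = η k ⬝ᵥ (P - ((AA - BB * K)ᵀ * P * (AA - BB * K) + (CCᵀ * Q * CC + Kᵀ * R * K))) *ᵥ η k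
        + 2 * (η k ⬝ᵥ (PAB - (AA - BB * K)ᵀ * P * BB) *ᵥ (u k + K *ᵥ η k))
        + (u k + K *ᵥ η k) ⬝ᵥ (PBB - BBᵀ * P * BB) *ᵥ (u k + K *ᵥ η k) := by
    intro hP k
    have hl : (dataPiHat N η u K *ᵥ Sum.elim (vech P) (Sum.elim PAB.vec (vech PBB))) k
        = -(η (k + 1) ⬝ᵥ P *ᵥ η (k + 1) - η k ⬝ᵥ P *ᵥ η k)
          + (2 * (η k ⬝ᵥ PAB *ᵥ (u k + K *ᵥ η k))
            + (u k + K *ᵥ η k) ⬝ᵥ PBB *ᵥ (u k + K *ᵥ η k)) := by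
      rw [← deltaSym_dotProduct_vech, ← deltaSym_dotProduct_vech, ← deltaPair_dotProduct_vec,
        ← deltaSym_dotProduct_vech, ← smul_eq_mul, ← smul_dotProduct, ← sub_dotProduct,
        ← neg_dotProduct, ← sumElim_dotProduct_sumElim,
        ← sumElim_dotProduct_sumElim]
      rfl
    have hr : (dataPhi N η y *ᵥ Sum.elim (vech Q) (vech (Kᵀ * R * K))) k
        = y k ⬝ᵥ Q *ᵥ y k + η k ⬝ᵥ (Kᵀ * R * K) *ᵥ η k := by
      rw [← deltaSym_dotProduct_vech, ← deltaSym_dotProduct_vech,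
        ← sumElim_dotProduct_sumElim]
      rfl
    have hη' : η (k + 1) = (AA - BB * K) *ᵥ η k + BB *ᵥ (u k + K *ᵥ η k) := by
      rw [hη, Matrix.sub_mulVec, Matrix.mulVec_add, Matrix.mulVec_mulVec]
      abel
    rw [hl, hr, hη', hy]
    generalize u k + K *ᵥ η k = w
    generalize AA - BB * K = F
    have e : (BB *ᵥ w) ⬝ᵥ P *ᵥ (F *ᵥ η k) = (F *ᵥ η k) ⬝ᵥ P *ᵥ (BB *ᵥ w) := by
      rw [Matrix.dotProduct_mulVec, dotProduct_comm, ← Matrix.mulVec_transpose, hP]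
    simp only [Matrix.add_mulVec, Matrix.sub_mulVec, Matrix.mulVec_add, dotProduct_add,
      dotProduct_sub, add_dotProduct, dotProduct_transpose_mul_mul_mulVec, e]
    ring
  constructor
  · rintro ⟨hP, hPBB, heq⟩
    have hP' : Pᵀ = P := hP
    have hPBB' : PBBᵀ = PBB := hPBB
    obtain ⟨h1, h2, h3⟩ := eq_zero_of_quad_data_eq_zero hrank K
      (Z₁ := P - ((AA - BB * K)ᵀ * P * (AA - BB * K) + (CCᵀ * Q * CC + Kᵀ * R * K)))
      (Z₂ := PAB - (AA - BB * K)ᵀ * P * BB) (Z₃ := PBB - BBᵀ * P * BB)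
      (by simp only [Matrix.transpose_sub, Matrix.transpose_add, Matrix.transpose_mul,
            Matrix.transpose_transpose, hP', hQ, hR, Matrix.mul_assoc])
      (by simp only [Matrix.transpose_sub, Matrix.transpose_mul,
            Matrix.transpose_transpose, hP', hPBB', Matrix.mul_assoc])
      (fun k => by rw [← hrow hP' k, heq, sub_self])
    exact ⟨hP', sub_eq_zero.1 h1, sub_eq_zero.1 h2, sub_eq_zero.1 h3⟩
  · rintro ⟨hP, hcost, rfl, rfl⟩
    refine ⟨hP, ?_, funext fun k => sub_eq_zero.1 ?_⟩
    · simp only [Matrix.IsSymm, Matrix.transpose_mul, Matrix.transpose_transpose, hP,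
        Matrix.mul_assoc]
    · rw [hrow hP k, sub_eq_zero.2 hcost]
      simp

/-- The terms in `K` cancel: `Bᵀ P (A - B K) + Bᵀ P B K = Bᵀ P A`. -/
theorem learned_update_eq_greedyGain {ι : Type*} [Fintype ι] {m : ℕ} {AA : Matrix ι ι ℝ}
    {BB : Matrix ι (Fin m) ℝ} {R : Matrix (Fin m) (Fin m) ℝ} (K : Matrix (Fin m) ι ℝ) {P : Matrix ι ι ℝ}
    (hP : Pᵀ = P) :
    (R + BBᵀ * P * BB)⁻¹ * (((AA - BB * K)ᵀ * P * BB)ᵀ + BBᵀ * P * BB * K)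
      = greedyGain AA BB R P := by
  rw [greedyGain]
  congr 1
  simp only [Matrix.transpose_mul, Matrix.transpose_transpose, hP, Matrix.mul_sub,
    Matrix.mul_assoc]
  abel

/-- With rich data, the model-free policy iteration can be carried out from a stabilizing gain. -/
theorem exists_isPIRun (hQ : Q.PosSemidef) (hR : R.PosDef)
    (hrank : (dataPi N η u).rank = (Fintype.card ι + m) * (Fintype.card ι + m + 1) / 2)
    (hη : ∀ k, η (k + 1) = AA *ᵥ η k + BB *ᵥ u k) (hy : ∀ k, y k = CC *ᵥ η k)
    {K₀ : Matrix (Fin m) ι ℝ} (hK₀ : IsSchur (AA - BB * K₀)) :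
    ∃ P PAB PBB K, IsPIRun N η u y Q R K₀ P PAB PBB K := by
  have hQ' := hQ.transpose_mul_mul CC
  have hex : ∀ K : {K : Matrix (Fin m) ι ℝ // IsSchur (AA - BB * K)},
      ∃ P, IsCost AA BB (CCᵀ * Q * CC) R K.1 P := fun K => exists_lyapunov K.2 _
  choose f hf using hex
  have hpsd := fun K => isCost_posSemidef hQ' hR K.2 (hf K)
  -- Iterating on the subtype of stabilizing gains keeps every cost equation solvable.
  let nxt : {K : Matrix (Fin m) ι ℝ // IsSchur (AA - BB * K)} →
      {K : Matrix (Fin m) ι ℝ // IsSchur (AA - BB * K)} := fun K =>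
    ⟨greedyGain AA BB R (f K), isSchur_greedyGain hQ' hR K.2 (hpsd K) (hf K)⟩
  let K := fun j => nxt^[j] ⟨K₀, hK₀⟩
  refine ⟨fun j => f (K j), fun j => (AA - BB * (K j).1)ᵀ * f (K j) * BB,
    fun j => BBᵀ * f (K j) * BB, fun j => (K j).1, rfl, fun j => ?_, fun j => ?_⟩
  · exact (solvesLearningEq_iff hQ.transpose_eq hR.posSemidef.transpose_eq hrank hη hy _ _ _ _).2
      ⟨(hpsd _).transpose_eq, hf _, rfl, rfl⟩
  · rw [learned_update_eq_greedyGain _ (hpsd _).transpose_eq]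
    simp only [K, Function.iterate_succ_apply', nxt]

/-- With rich data, the gains of the model-free policy iteration converge to the greedy gain of a
solution of the Riccati equation. -/
theorem IsPIRun.tendsto (hQ : Q.PosSemidef) (hR : R.PosDef)
    (hrank : (dataPi N η u).rank = (Fintype.card ι + m) * (Fintype.card ι + m + 1) / 2)
    (hη : ∀ k, η (k + 1) = AA *ᵥ η k + BB *ᵥ u k) (hy : ∀ k, y k = CC *ᵥ η k)
    {K₀ : Matrix (Fin m) ι ℝ} (hK₀ : IsSchur (AA - BB * K₀))
    {P : ℕ → Matrix ι ι ℝ} {PAB : ℕ → Matrix ι (Fin m) ℝ}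
    {PBB : ℕ → Matrix (Fin m) (Fin m) ℝ} {K : ℕ → Matrix (Fin m) ι ℝ}
    (h : IsPIRun N η u y Q R K₀ P PAB PBB K) :
    ∃ Pinf : Matrix ι ι ℝ, Pinf.PosSemidef ∧
      IsCost AA BB (CCᵀ * Q * CC) R (greedyGain AA BB R Pinf) Pinf ∧
      Tendsto K atTop (𝓝 (greedyGain AA BB R Pinf)) := by
  have hl := fun j => (solvesLearningEq_iff hQ.transpose_eq hR.posSemidef.transpose_eq hrank hη hy
    _ _ _ _).1 (h.learning j)
  refine policyIteration_tendsto (hQ.transpose_mul_mul CC) hR (h.init.symm ▸ hK₀)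
    (fun j => (hl j).2.1) fun j => ?_
  obtain ⟨h1, -, h3, h4⟩ := hl j
  rw [h.update, h3, h4, learned_update_eq_greedyGain _ h1]

end Learning

/-! ### The internal model as a lift of the plant -/

section InternalModel
open Matrix

variable {n m p : ℕ}

/-- The input columns of `𝒢₂`. -/
def inputCols (n m p : ℕ) : Matrix (EtaIdx n m p) (Fin m) ℝ :=
  (internalG2 n m p).submatrix id (fun a : Fin m => Sum.inl a)

/-- The output columns of `𝒢₂`. -/
def outputCols (n m p : ℕ) : Matrix (EtaIdx n m p) (Fin p) ℝ :=
  (internalG2 n m p).submatrix id (fun b : Fin p => Sum.inr (Sum.inl b))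

theorem internalG2_mulVec_zetaVec (u : Fin m → ℝ) (y : Fin p → ℝ) :
    internalG2 n m p *ᵥ zetaVec u y = inputCols n m p *ᵥ u + outputCols n m p *ᵥ y := by
  funext q
  simp [Matrix.mulVec, dotProduct, zetaVec, inputCols, outputCols]

/-- The columns of `M` that belong to the channel `c`. -/
def channelCols {ν : Type*} (M : Matrix ν (EtaIdx n m p) ℝ) (c : Chan m p) : Matrix ν (Fin n) ℝ :=
  Matrix.of fun i k => M i (k, c)

theorem mul_inputCols_apply {ν : Type*} (M : Matrix ν (EtaIdx n m p) ℝ) (i : ν) (a : Fin m) :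
    (M * inputCols n m p) i a = (channelCols M (Sum.inl a) *ᵥ lastVec n) i := by
  simp [Matrix.mul_apply, Matrix.mulVec, dotProduct, inputCols, internalG2, channelCols,
    Fintype.sum_prod_type]

theorem mul_outputCols_apply {ν : Type*} (M : Matrix ν (EtaIdx n m p) ℝ) (i : ν) (b : Fin p) :
    (M * outputCols n m p) i b = (channelCols M (Sum.inr (Sum.inl b)) *ᵥ lastVec n) i := by
  simp [Matrix.mul_apply, Matrix.mulVec, dotProduct, outputCols, internalG2, channelCols,
    Fintype.sum_prod_type]

theorem channelCols_mul_blockDiagonal {ν : Type*} (M : Matrix ν (EtaIdx n m p) ℝ)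
    (D : Chan m p → Matrix (Fin n) (Fin n) ℝ) (c : Chan m p) :
    channelCols (M * Matrix.blockDiagonal D) c = channelCols M c * D c := by
  ext i k
  simp only [channelCols, Matrix.of_apply, Matrix.mul_apply, Matrix.blockDiagonal_apply,
    Fintype.sum_prod_type, mul_ite, mul_zero, Finset.sum_ite_eq', Finset.mem_univ, if_true]

theorem channelCols_mul {ν ν' : Type*} [Fintype ν'] (X : Matrix ν ν' ℝ)
    (M : Matrix ν' (EtaIdx n m p) ℝ) (c : Chan m p) :
    channelCols (X * M) c = X * channelCols M c := rfl

theorem eq_of_channelCols_eq {ν : Type*} {M M' : Matrix ν (EtaIdx n m p) ℝ}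
    (h : ∀ c, channelCols M c = channelCols M' c) : M = M' := by
  ext i ⟨k, c⟩
  exact congrFun (congrFun (h c) i) k

variable {A : Matrix (Fin n) (Fin n) ℝ} {B : Matrix (Fin n) (Fin m) ℝ}
  {C : Matrix (Fin p) (Fin n) ℝ} {L : Matrix (Fin n) (Fin p) ℝ} {Aeps : Matrix (Fin n) (Fin n) ℝ}
  {x0 : Fin n → ℝ} {η0 : EtaIdx n m p → ℝ}

theorem paramMatrix_mul_inputCols :
    paramMatrix A B C L Aeps x0 η0 * inputCols n m p = B := by
  ext i a
  rw [mul_inputCols_apply]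
  exact congrFun (coeffMat_mulVec_lastVec (A - L * C) fun r => B r a) i

theorem paramMatrix_mul_outputCols :
    paramMatrix A B C L Aeps x0 η0 * outputCols n m p = L := by
  ext i b
  rw [mul_outputCols_apply]
  exact congrFun (coeffMat_mulVec_lastVec (A - L * C) fun r => L r b) i

/-- Each input or output block intertwines the companion matrix with `A_L`. In the error block, `G`
conjugates `Aeps` to the same companion matrix, because the characteristic polynomials agree, so `E
G⁻¹` intertwines `Aeps` with `A_L`. -/
theorem paramMatrix_mul_internalG1 (hAeps : Aeps.charpoly = (A - L * C).charpoly)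
    (hMη : IsUnit (coeffMat Aeps (errorBlock η0)).det) :
    paramMatrix A B C L Aeps x0 η0 * internalG1 m p (A - L * C) Aeps
      = (A - L * C) * paramMatrix A B C L Aeps x0 η0 := by
  refine eq_of_channelCols_eq fun c => ?_
  rw [internalG1, channelCols_mul_blockDiagonal, channelCols_mul]
  match c with
  | Sum.inl a => exact coeffMat_mul_companionMat (A - L * C) fun r => B r a
  | Sum.inr (Sum.inl b) => exact coeffMat_mul_companionMat (A - L * C) fun r => L r b
  | Sum.inr (Sum.inr _) =>
    set E := coeffMat (A - L * C) (x0 - observerState A B C L η0) with hE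
    set G := coeffMat Aeps (errorBlock η0) with hG
    have h1 : E * companionMat n (A - L * C).charpoly = (A - L * C) * E :=
      coeffMat_mul_companionMat _ _
    have h2 : G * companionMat n (A - L * C).charpoly = Aeps * G := by
      rw [← hAeps]
      exact coeffMat_mul_companionMat _ _
    change E * G⁻¹ * Aeps = (A - L * C) * (E * G⁻¹)
    rw [← Matrix.mul_assoc, ← h1, Matrix.mul_assoc, Matrix.mul_assoc]
    congr 1
    calc G⁻¹ * Aeps = G⁻¹ * (Aeps * G) * G⁻¹ := by
          rw [Matrix.mul_assoc, Matrix.mul_assoc, Matrix.mul_nonsing_inv _ hMη, Matrix.mul_one]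
      _ = companionMat n (A - L * C).charpoly * G⁻¹ := by
          rw [← h2, ← Matrix.mul_assoc, Matrix.nonsing_inv_mul _ hMη, Matrix.one_mul]

/-- The coefficient matrices send `b` to their vectors, so `M_η⁻¹ η_ε(0) = b` and `M_ε b` is the
initial observer error. The error block thus adds exactly what `x̂(0)` lacks. -/
theorem paramMatrix_mulVec_initial (hMη : IsUnit (coeffMat Aeps (errorBlock η0)).det) :
    paramMatrix A B C L Aeps x0 η0 *ᵥ η0 = x0 := by
  have h1 : paramMatrix A B C L Aeps x0 η0 *ᵥ η0 = observerState A B C L η0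
      + (coeffMat (A - L * C) (x0 - observerState A B C L η0)
          * (coeffMat Aeps (errorBlock η0))⁻¹) *ᵥ errorBlock η0 := by
    funext i
    simp only [Matrix.mulVec, dotProduct, Fintype.sum_prod_type_right, Fintype.sum_sum_type,
      observerState, Pi.add_apply, Finset.sum_apply, add_assoc, Finset.univ_unique,
      Finset.sum_singleton]
    rfl
  have h2 : (coeffMat Aeps (errorBlock η0))⁻¹ *ᵥ errorBlock η0 = lastVec n := by
    conv_lhs => rw [← coeffMat_mulVec_lastVec Aeps (errorBlock η0)]
    rw [Matrix.mulVec_mulVec, coeffMat_mulVec_lastVec, Matrix.nonsing_inv_mul _ hMη,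
      Matrix.one_mulVec]
  rw [h1, ← Matrix.mulVec_mulVec, h2, coeffMat_mulVec_lastVec, add_sub_cancel]

/-- The internal model driven by the output `y = C M η`. -/
noncomputable def liftedA (A : Matrix (Fin n) (Fin n) ℝ) (C : Matrix (Fin p) (Fin n) ℝ)
    (L : Matrix (Fin n) (Fin p) ℝ) (Aeps : Matrix (Fin n) (Fin n) ℝ)
    (M : Matrix (Fin n) (EtaIdx n m p) ℝ) : Matrix (EtaIdx n m p) (EtaIdx n m p) ℝ :=
  internalG1 m p (A - L * C) Aeps + outputCols n m p * (C * M)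

variable {M : Matrix (Fin n) (EtaIdx n m p) ℝ}

theorem mul_liftedA (hG1 : M * internalG1 m p (A - L * C) Aeps = (A - L * C) * M)
    (hGy : M * outputCols n m p = L) : M * liftedA A C L Aeps M = A * M := by
  rw [liftedA, Matrix.mul_add, hG1, ← Matrix.mul_assoc M, hGy, Matrix.sub_mul, Matrix.mul_assoc]
  abel

/-- The mismatch `x - M η` evolves by `A_L` and starts at zero. The unmeasured state is thereby an
exact function of `η`, with no transient. -/
theorem trajectory_eq_mulVec {x : ℕ → Fin n → ℝ} {u : ℕ → Fin m → ℝ} {y : ℕ → Fin p → ℝ}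
    {η : ℕ → EtaIdx n m p → ℝ}
    (hG1 : M * internalG1 m p (A - L * C) Aeps = (A - L * C) * M)
    (hGu : M * inputCols n m p = B) (hGy : M * outputCols n m p = L)
    (hx : ∀ k, x (k + 1) = A *ᵥ x k + B *ᵥ u k) (hy : ∀ k, y k = C *ᵥ x k)
    (hη : ∀ k, η (k + 1) = internalG1 m p (A - L * C) Aeps *ᵥ η k
      + internalG2 n m p *ᵥ zetaVec (u k) (y k))
    (h0 : M *ᵥ η 0 = x 0) (k : ℕ) : M *ᵥ η k = x k := by
  induction k with
  | zero => exact h0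
  | succ k ih =>
    rw [hη, hx, internalG2_mulVec_zetaVec, Matrix.mulVec_add, Matrix.mulVec_add,
      Matrix.mulVec_mulVec, Matrix.mulVec_mulVec, Matrix.mulVec_mulVec, hG1, hGu, hGy,
      ← Matrix.mulVec_mulVec, ih, hy, Matrix.sub_mulVec, Matrix.mulVec_mulVec]
    abel

theorem closedLoop_eq (K : Matrix (Fin m) (EtaIdx n m p) ℝ) :
    closedLoop A B C L Aeps K = Matrix.fromBlocks A (-(B * K)) (outputCols n m p * C)
      (internalG1 m p (A - L * C) Aeps - inputCols n m p * K) := rfl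

/-- The observer error is a quotient of an admissible closed loop. -/
theorem IsAdmissible.isSchur_observer
    (hG1 : M * internalG1 m p (A - L * C) Aeps = (A - L * C) * M)
    (hGu : M * inputCols n m p = B) (hGy : M * outputCols n m p = L)
    {K : Matrix (Fin m) (EtaIdx n m p) ℝ} (hK : IsAdmissible A B C L Aeps K) :
    IsSchur (A - L * C) := by
  -- The quotient map is `(x, η) ↦ x - M η`.
  refine IsSchur.of_quotient hK (T := Matrix.fromCols 1 (-M)) (T' := Matrix.fromRows 1 0)
    (by rw [Matrix.fromCols_mul_fromRows]; simp) ?_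
  rw [closedLoop_eq, Matrix.fromCols_mul_fromBlocks, Matrix.mul_fromCols]
  congr 1
  · rw [Matrix.one_mul, Matrix.neg_mul, ← Matrix.mul_assoc, hGy, Matrix.mul_one, sub_eq_add_neg]
  · rw [Matrix.one_mul, Matrix.neg_mul, Matrix.mul_sub, hG1, ← Matrix.mul_assoc, hGu,
      Matrix.mul_neg]
    abel

/-- The lifted plant is the restriction of an admissible closed loop to `x = M η`. -/
theorem IsAdmissible.isSchur_lifted
    (hG1 : M * internalG1 m p (A - L * C) Aeps = (A - L * C) * M)
    (hGu : M * inputCols n m p = B) (hGy : M * outputCols n m p = L)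
    {K : Matrix (Fin m) (EtaIdx n m p) ℝ} (hK : IsAdmissible A B C L Aeps K) :
    IsSchur (liftedA A C L Aeps M - inputCols n m p * K) := by
  -- The invariant subspace `x = M η` is parameterized by `η`.
  refine IsSchur.of_restrict hK (J := Matrix.fromRows M 1) (J' := Matrix.fromCols 0 1)
    (by rw [Matrix.fromCols_mul_fromRows]; simp) ?_
  rw [closedLoop_eq, Matrix.fromBlocks_mul_fromRows, Matrix.fromRows_mul]
  congr 1
  · rw [Matrix.mul_sub, mul_liftedA hG1 hGy, ← Matrix.mul_assoc M, hGu, Matrix.mul_one,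
      sub_eq_add_neg]
  · rw [liftedA, Matrix.one_mul, Matrix.mul_one, Matrix.mul_assoc]
    abel

/-- `Aeps` is Schur as it shares its characteristic polynomial with `A_L`, and the invertible
`coeffMat Aeps v` conjugates it to the companion matrix; the powers are then taken blockwise. -/
theorem internalG1_tendsto_pow (hAeps : Aeps.charpoly = (A - L * C).charpoly) {v : Fin n → ℝ}
    (hv : IsUnit (coeffMat Aeps v).det) (hAL : IsSchur (A - L * C)) :
    Tendsto (fun k => internalG1 m p (A - L * C) Aeps ^ k) atTop (𝓝 0) := by
  have hS : IsSchur Aeps := isSchur_of_charpoly_eq hAL hAeps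
  have hcomp : IsSchur (companionMat n (A - L * C).charpoly) := by
    rw [← hAeps]
    exact hS.of_restrict (Matrix.nonsing_inv_mul _ hv) (coeffMat_mul_companionMat Aeps v).symm
  have hD : ∀ D : Chan m p → Matrix (Fin n) (Fin n) ℝ, (∀ c, IsSchur (D c)) →
      Tendsto (fun k => Matrix.blockDiagonal D ^ k) atTop (𝓝 0) := by
    intro D hD
    have hc : Continuous fun Z : Chan m p → Matrix (Fin n) (Fin n) ℝ => Matrix.blockDiagonal Z := by
      fun_prop
    have ht : Tendsto (fun k => D ^ k) atTop (𝓝 0) :=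
      tendsto_pi_nhds.2 fun c => (hD c).tendsto_pow
    have := (hc.tendsto 0).comp ht
    simpa [Function.comp_def, Matrix.blockDiagonal_pow] using this
  refine hD _ fun c => ?_
  match c with
  | Sum.inl _ => exact hcomp
  | Sum.inr (Sum.inl _) => exact hcomp
  | Sum.inr (Sum.inr _) => exact hS

/-- `ker M` is invariant under `𝒢₁`, and the output feedback term vanishes on it. -/
theorem liftedA_pow_mulVec (hG1 : M * internalG1 m p (A - L * C) Aeps = (A - L * C) * M)
    {w : EtaIdx n m p → ℝ} (hw : M *ᵥ w = 0) (k : ℕ) :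
    M *ᵥ (liftedA A C L Aeps M ^ k *ᵥ w) = 0 ∧
      liftedA A C L Aeps M ^ k *ᵥ w = internalG1 m p (A - L * C) Aeps ^ k *ᵥ w := by
  have hM : ∀ k, M *ᵥ (internalG1 m p (A - L * C) Aeps ^ k *ᵥ w) = 0 := fun k => by
    rw [Matrix.mulVec_mulVec, intertwine_pow hG1, ← Matrix.mulVec_mulVec, hw, Matrix.mulVec_zero]
  suffices h : liftedA A C L Aeps M ^ k *ᵥ w = internalG1 m p (A - L * C) Aeps ^ k *ᵥ w by
    exact ⟨h ▸ hM k, h⟩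
  induction k with
  | zero => simp
  | succ k ih =>
    rw [pow_succ', ← Matrix.mulVec_mulVec, ih, liftedA, Matrix.add_mulVec,
      ← Matrix.mulVec_mulVec, ← Matrix.mulVec_mulVec, hM, Matrix.mulVec_zero, Matrix.mulVec_zero,
      add_zero, pow_succ', Matrix.mulVec_mulVec]

end InternalModel

/-! ### Riccati solutions of the plant and of a lift -/

section Riccati
open Matrix

variable {n m p : ℕ} {A : Matrix (Fin n) (Fin n) ℝ} {B : Matrix (Fin n) (Fin m) ℝ}
  {C : Matrix (Fin p) (Fin n) ℝ} {Q : Matrix (Fin p) (Fin p) ℝ} {R : Matrix (Fin m) (Fin m) ℝ}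

theorem lqrGain_eq_greedyGain (P : Matrix (Fin n) (Fin n) ℝ) :
    lqrGain A B R P = greedyGain A B R P := by
  simp only [lqrGain, greedyGain, Matrix.mul_assoc]

theorem isRiccatiSolution_iff (hR : R.PosDef) (P : Matrix (Fin n) (Fin n) ℝ) :
    IsRiccatiSolution A B C Q R P ↔
      P.PosSemidef ∧ IsCost A B (Cᵀ * Q * C) R (greedyGain A B R P) P :=
  and_congr_right fun hP => (isCost_greedyGain_iff hR hP).symm

/-- On an eigenplane outside the open disc the weight vanishes, so `K x = 0` and `S x = 0`. The
plane is then `A`-invariant inside `ker S`, contradicting observability unless it is zero. -/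
theorem isSchur_of_isObservable (hQ : Q.PosSemidef) (hR : R.PosDef)
    {S : Matrix (Fin n) (Fin n) ℝ} (hS : Sᵀ = S) (hSS : S * S = Cᵀ * Q * C)
    (hAS : IsObservable A S) {K : Matrix (Fin m) (Fin n) ℝ} {P : Matrix (Fin n) (Fin n) ℝ}
    (hP : P.PosSemidef) (h : IsCost A B (Cᵀ * Q * C) R K P) : IsSchur (A - B * K) := by
  have hW1 := hQ.transpose_mul_mul C
  have hW2 := hR.posSemidef.transpose_mul_mul K
  refine isSchur_of_lyapunov hP (hW1.add hW2) h ?_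
  intro α β a b ha hb hab hWa hWb
  have hx : ∀ x : Fin n → ℝ, x ⬝ᵥ (Cᵀ * Q * C + Kᵀ * R * K) *ᵥ x = 0 →
      S *ᵥ x = 0 ∧ (A - B * K) *ᵥ x = A *ᵥ x := by
    intro x hx
    rw [Matrix.add_mulVec, dotProduct_add] at hx
    have h1 := hW1.quad_nonneg x
    have h2 := hW2.quad_nonneg x
    have h3 : x ⬝ᵥ (Kᵀ * R * K) *ᵥ x = 0 := le_antisymm (by linarith) h2
    have h4 : x ⬝ᵥ (Cᵀ * Q * C) *ᵥ x = 0 := le_antisymm (by linarith) h1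
    rw [dotProduct_transpose_mul_mul_mulVec] at h3
    have h5 := hR.eq_zero_of_quad_eq_zero h3
    rw [← hSS] at h4
    nth_rewrite 1 [← hS] at h4
    rw [← Matrix.mulVec_mulVec, Matrix.dotProduct_mulVec, Matrix.vecMul_transpose] at h4
    refine ⟨dotProduct_self_eq_zero.1 h4, ?_⟩
    rw [Matrix.sub_mulVec, ← Matrix.mulVec_mulVec, h5, Matrix.mulVec_zero, sub_zero]
  obtain ⟨hSa, hKa⟩ := hx a hWa
  obtain ⟨hSb, hKb⟩ := hx b hWb
  rw [hKa] at ha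
  rw [hKb] at hb
  have hpow : ∀ k : ℕ, (S * A ^ k) *ᵥ a = 0 ∧ (S * A ^ k) *ᵥ b = 0 := by
    intro k
    induction k with
    | zero => simpa using ⟨hSa, hSb⟩
    | succ k ih =>
      rw [pow_succ, ← Matrix.mul_assoc, ← Matrix.mulVec_mulVec _ (S * A ^ k),
        ← Matrix.mulVec_mulVec _ (S * A ^ k), ha, hb]
      simp [Matrix.mulVec_sub, Matrix.mulVec_add, Matrix.mulVec_smul, ih.1, ih.2]
  exact ⟨hAS a fun k => (hpow k).1, hAS b fun k => (hpow k).2⟩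

theorem isRiccatiSolution_unique (hQ : Q.PosSemidef) (hR : R.PosDef)
    {S : Matrix (Fin n) (Fin n) ℝ} (hS : Sᵀ = S) (hSS : S * S = Cᵀ * Q * C)
    (hAS : IsObservable A S) {P P' : Matrix (Fin n) (Fin n) ℝ}
    (hP : IsRiccatiSolution A B C Q R P) (hP' : IsRiccatiSolution A B C Q R P') : P = P' := by
  rw [isRiccatiSolution_iff hR] at hP hP'
  exact riccati_unique hR hP.1 hP.2 (isSchur_of_isObservable hQ hR hS hSS hAS hP.1 hP.2)
    hP'.1 hP'.2 (isSchur_of_isObservable hQ hR hS hSS hAS hP'.1 hP'.2)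

variable {ι : Type*} [Fintype ι] [DecidableEq ι] {AA : Matrix ι ι ℝ} {BB : Matrix ι (Fin m) ℝ}
  {M : Matrix (Fin n) ι ℝ}

/-- A Riccati solution of a lift of the plant that vanishes on the kernel of the lift comes from a
Riccati solution of the plant. -/
theorem exists_isRiccatiSolution_of_lift (hR : R.PosDef) (hA : M * AA = A * M) (hB : M * BB = B)
    {M' : Matrix ι (Fin n) ℝ} (hM : M * M' = 1) {P : Matrix ι ι ℝ} (hP : P.PosSemidef)
    (h : IsCost AA BB ((C * M)ᵀ * Q * (C * M)) R (greedyGain AA BB R P) P)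
    (hker : ∀ w, M *ᵥ w = 0 → P *ᵥ w = 0) :
    ∃ X, IsRiccatiSolution A B C Q R X ∧ greedyGain AA BB R P = lqrGain A B R X * M := by
  -- The vector `w - M' M w` lies in `ker M`, where `P` vanishes.
  have h1 : P = P * (M' * M) := by
    refine Matrix.ext_of_mulVec_single fun i => ?_
    have h2 := hker (Pi.single i 1 - (M' * M) *ᵥ Pi.single i 1) (by
      rw [Matrix.mulVec_sub, Matrix.mulVec_mulVec, ← Matrix.mul_assoc, hM, Matrix.one_mul,
        sub_self])
    rw [Matrix.mulVec_sub, Matrix.mulVec_mulVec, sub_eq_zero] at h2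
    exact h2
  have h2 : P = (M' * M)ᵀ * P := by
    have := congrArg Matrix.transpose h1
    rwa [Matrix.transpose_mul, hP.transpose_eq] at this
  obtain ⟨X, hX⟩ : ∃ X, X = M'ᵀ * P * M' := ⟨_, rfl⟩
  have hPX : P = Mᵀ * X * M := by
    rw [hX]
    nth_rewrite 1 [h2, h1]
    simp only [Matrix.transpose_mul, Matrix.mul_assoc]
  have hXpsd : X.PosSemidef := hX ▸ hP.transpose_mul_mul M'
  have hgain : greedyGain AA BB R P = greedyGain A B R X * M := by
    have e1 : BBᵀ * P * BB = Bᵀ * X * B := by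
      rw [hPX, ← hB]
      simp only [Matrix.transpose_mul, Matrix.mul_assoc]
    have e2 : BBᵀ * P * AA = Bᵀ * X * A * M := by
      rw [Matrix.mul_assoc _ A, ← hA, hPX, ← hB]
      simp only [Matrix.transpose_mul, Matrix.mul_assoc]
    rw [greedyGain, greedyGain, e1, e2]
    simp only [Matrix.mul_assoc]
  refine ⟨X, (isRiccatiSolution_iff hR X).2 ⟨hXpsd, ?_⟩, by rw [hgain, lqrGain_eq_greedyGain]⟩
  rw [hgain, IsCost] at h
  generalize greedyGain A B R X = G at h ⊢
  have hF : M * (AA - BB * (G * M)) = (A - B * G) * M := by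
    rw [Matrix.mul_sub, hA, ← Matrix.mul_assoc, hB, Matrix.sub_mul, Matrix.mul_assoc B]
  have hlift : ∀ Z : Matrix (Fin n) (Fin n) ℝ, M'ᵀ * (Mᵀ * Z * M) * M' = Z := fun Z => by
    have hM2 : M'ᵀ * Mᵀ = 1 := by rw [← Matrix.transpose_mul, hM, Matrix.transpose_one]
    rw [Matrix.mul_assoc, Matrix.mul_assoc _ M, hM, Matrix.mul_one, ← Matrix.mul_assoc, hM2,
      Matrix.one_mul]
  -- The lifted cost equation is the plant's one between `Mᵀ` and `M`; the right inverse `M'` strips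
  -- these factors.
  have h3 : Mᵀ * X * M = Mᵀ * ((A - B * G)ᵀ * X * (A - B * G) + (Cᵀ * Q * C + Gᵀ * R * G)) * M := by
    have e1 : (AA - BB * (G * M))ᵀ * (Mᵀ * X * M) * (AA - BB * (G * M))
        = Mᵀ * ((A - B * G)ᵀ * X * (A - B * G)) * M := by
      have : (AA - BB * (G * M))ᵀ * Mᵀ = Mᵀ * (A - B * G)ᵀ := by
        rw [← Matrix.transpose_mul, hF, Matrix.transpose_mul]
      calc _ = (AA - BB * (G * M))ᵀ * Mᵀ * X * (M * (AA - BB * (G * M))) := by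
            simp only [Matrix.mul_assoc]
        _ = _ := by
            rw [this, hF]
            simp only [Matrix.mul_assoc]
    rw [← hPX, h]
    rw [hPX, e1]
    simp only [Matrix.mul_add, Matrix.add_mul, Matrix.transpose_mul, Matrix.mul_assoc]
  have h4 := congrArg (fun Z => M'ᵀ * Z * M') h3
  simp only [hlift] at h4
  exact h4

theorem exists_right_inverse_of_rank_eq {n : ℕ} {ι : Type*} [Fintype ι]
    {M : Matrix (Fin n) ι ℝ} (h : M.rank = n) : ∃ M' : Matrix ι (Fin n) ℝ, M * M' = 1 := by
  rw [← Matrix.mulVec_surjective_iff_exists_right_inverse]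
  have : LinearMap.range M.mulVecLin = ⊤ :=
    Submodule.eq_top_of_finrank_eq (by rw [Module.finrank_fin_fun]; exact h)
  exact LinearMap.range_eq_top.1 this

end Riccati

/-! ### Convergence of the model-free iteration. -/

theorem theorem5 {n m p : ℕ}
    -- the plant, with `(A, B)` stabilizable and `(A, C)` observable
    (A : Matrix (Fin n) (Fin n) ℝ) (B : Matrix (Fin n) (Fin m) ℝ) (C : Matrix (Fin p) (Fin n) ℝ)
    (hAB : IsStabilizable A B) (hAC : IsObservable A C)
    -- the weights, with `(A, √(Cᵀ Q C))` observable
    (Q : Matrix (Fin p) (Fin p) ℝ) (R : Matrix (Fin m) (Fin m) ℝ)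
    (hQ : Q.PosSemidef) (hR : R.PosDef)
    (S : Matrix (Fin n) (Fin n) ℝ) (hS : S.PosSemidef) (hSS : S * S = C.transpose * Q * C)
    (hAS : IsObservable A S)
    -- the observer gain and the user-defined error block of the internal model
    (L : Matrix (Fin n) (Fin p) ℝ) (Aeps : Matrix (Fin n) (Fin n) ℝ)
    (hAeps : Aeps.charpoly = (A - L * C).charpoly)
    -- the initial admissible gain
    (K₀ : Matrix (Fin m) (EtaIdx n m p) ℝ) (hK₀ : IsAdmissible A B C L Aeps K₀)
    -- the data: trajectories of plant and internal model under `u = -K₀ η + ξ`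
    (x : ℕ → Fin n → ℝ) (u : ℕ → Fin m → ℝ) (y : ℕ → Fin p → ℝ) (η : ℕ → EtaIdx n m p → ℝ)
    (ξ : ℕ → Fin m → ℝ)
    (hx : ∀ k, x (k + 1) = Matrix.mulVec A (x k) + Matrix.mulVec B (u k))
    (hy : ∀ k, y k = Matrix.mulVec C (x k))
    (hη : ∀ k, η (k + 1) = Matrix.mulVec (internalG1 m p (A - L * C) Aeps) (η k)
      + Matrix.mulVec (internalG2 n m p) (zetaVec (u k) (y k)))
    (hu : ∀ k, u k = -Matrix.mulVec K₀ (η k) + ξ k)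
    -- the initial error block makes `M_η` nonsingular
    (hMη : IsUnit (coeffMat Aeps (errorBlock (η 0))).det)
    -- the two rank conditions
    (N : ℕ)
    (hrank : (dataPi N η u).rank
      = (n * (m + p + 1) + m) * (n * (m + p + 1) + m + 1) / 2)
    (hM : (paramMatrix A B C L Aeps (x 0) (η 0)).rank = n) :
    (∃! P : Matrix (Fin n) (Fin n) ℝ, IsRiccatiSolution A B C Q R P) ∧
    (∃ P PAB PBB K, IsPIRun N η u y Q R K₀ P PAB PBB K) ∧
    ∀ Pstar : Matrix (Fin n) (Fin n) ℝ, IsRiccatiSolution A B C Q R Pstar →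
      ∀ P PAB PBB K, IsPIRun N η u y Q R K₀ P PAB PBB K →
        Tendsto K atTop (𝓝 (lqrGain A B R Pstar * paramMatrix A B C L Aeps (x 0) (η 0))) := by
  set M := paramMatrix A B C L Aeps (x 0) (η 0) with hMdef
  have hG1 : M * internalG1 m p (A - L * C) Aeps = (A - L * C) * M :=
    paramMatrix_mul_internalG1 hAeps hMη
  have hGu : M * inputCols n m p = B := paramMatrix_mul_inputCols
  have hGy : M * outputCols n m p = L := paramMatrix_mul_outputCols
  have hxM := trajectory_eq_mulVec hG1 hGu hGy hx hy hη (paramMatrix_mulVec_initial hMη)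
  have hyM : ∀ k, y k = Matrix.mulVec (C * M) (η k) := fun k => by
    rw [hy, ← hxM, Matrix.mulVec_mulVec]
  have hηM : ∀ k, η (k + 1) = Matrix.mulVec (liftedA A C L Aeps M) (η k)
      + Matrix.mulVec (inputCols n m p) (u k) := fun k => by
    rw [hη, internalG2_mulVec_zetaVec, hyM, liftedA, Matrix.add_mulVec, Matrix.mulVec_mulVec]
    abel
  have hrank' : (dataPi N η u).rank
      = (Fintype.card (EtaIdx n m p) + m) * (Fintype.card (EtaIdx n m p) + m + 1) / 2 := by
    rw [hrank]
    simp [add_assoc]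
  have hStab := hK₀.isSchur_lifted hG1 hGu hGy
  have hAL := hK₀.isSchur_observer hG1 hGu hGy
  obtain ⟨M', hM'⟩ := exists_right_inverse_of_rank_eq hM
  have hlim : ∀ P PAB PBB K, IsPIRun N η u y Q R K₀ P PAB PBB K →
      ∃ X, IsRiccatiSolution A B C Q R X ∧ Tendsto K atTop (𝓝 (lqrGain A B R X * M)) := by
    intro P PAB PBB K hrun
    obtain ⟨Pinf, hpsd, hcost, ht⟩ := hrun.tendsto hQ hR hrank' hηM hyM hStab
    obtain ⟨X, hX, hgain⟩ := exists_isRiccatiSolution_of_lift hR (mul_liftedA hG1 hGy) hGu hM'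
      hpsd hcost fun w hw => by
        have hpow := liftedA_pow_mulVec hG1 hw
        refine riccati_mulVec_eq_zero hR hpsd hcost (fun k => ?_) ?_
        · rw [dotProduct_transpose_mul_mul_mulVec, ← Matrix.mulVec_mulVec, (hpow k).1]
          simp
        · simp only [fun k => (hpow k).2]
          have hc : Continuous fun Z : Matrix (EtaIdx n m p) (EtaIdx n m p) ℝ =>
              Matrix.mulVec Z w := by fun_prop
          simpa [Function.comp_def] using
            (hc.tendsto 0).comp (internalG1_tendsto_pow hAeps hMη hAL)
    exact ⟨X, hX, hgain ▸ ht⟩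
  have huniq : ∀ {P P' : Matrix (Fin n) (Fin n) ℝ}, IsRiccatiSolution A B C Q R P →
      IsRiccatiSolution A B C Q R P' → P = P' :=
    isRiccatiSolution_unique hQ hR hS.transpose_eq hSS hAS
  have hex : ∃ P PAB PBB K, IsPIRun N η u y Q R K₀ P PAB PBB K :=
    exists_isPIRun hQ hR hrank' hηM hyM hStab
  refine ⟨?_, hex, fun Pstar hPstar P PAB PBB K hrun => ?_⟩
  -- Existence of a Riccati solution is read off from the limit of a run.
  · obtain ⟨P, PAB, PBB, K, hrun⟩ := hex
    obtain ⟨X, hX, -⟩ := hlim P PAB PBB K hrun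
    exact ⟨X, hX, fun Y hY => huniq hY hX⟩
  · obtain ⟨X, hX, ht⟩ := hlim P PAB PBB K hrun
    rwa [huniq hPstar hX]
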